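/- All systems are finite-dimensional with a fixed orthonormal basis, $\log$ is the binary logarithm with $\log 0=-\infty$, and divergences take values in $[-\infty,\infty]$. For a bipartite system $XY$ let $\mathrm{PPT}'(X:Y)$ be the set of positive semidefinite operators $\sigma_{XY}$ with $\|\sigma_{XY}^{\top_Y}\|_1\le 1$, where $\top_Y$ is the partial transpose on $Y$ and $\|\cdot\|_1$ the trace norm. Quantum channels are completely positive trace-preserving maps. For $\alpha\in(1,\infty)$ and positive semidefinite $\rho,\sigma$ let $$\widetilde D_\alpha(\rho\|\sigma)=\frac1{\alpha-1}\log\mathrm{tr}\Big(\big(\sigma^{\frac{1-\alpha}{2\alpha}}\rho\,\sigma^{\frac{1-\alpha}{2\alpha}}\big)^\alpha\Big)$$ (inverse powers on the support) if $\mathrm{supp}\,\rho\subseteq\mathrm{supp}\,\sigma$, and $\widetilde D_\alpha(\rho\|\sigma)=\infty$ otherwise. For completely positive maps $\mathcal N,\mathcal M$ from $X$ to $Y$ with Choi operators $J^{\mathcal N},J^{\mathcal M}$ on $XY$ let $$\widetilde D_\alpha(\mathcal N\|\mathcal M)=\sup_{\omega_X}\widetilde D_\alpha\big(\omega_X^{1/2}J^{\mathcal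 N}\omega_X^{1/2}\,\big\|\,\omega_X^{1/2}J^{\mathcal M}\omega_X^{1/2}\big),$$ the supremum being over density operators $\omega_X$ on $X$, and $$\widetilde D^{\mathrm{reg}}_\alpha(\mathcal N\|\mathcal M)=\lim_{m\to\infty}\tfrac1m\widetilde D_\alpha(\mathcal N^{\otimes m}\|\mathcal M^{\otimes m}).$$ **Proposition.** Let $\mathcal N$ be a quantum channel from $X$ to $Y$, let $n,k\ge 1$ be integers and $\varepsilon\in[0,1]$. Let $\rho^{(0)}$ be a density operator in $\mathrm{PPT}'(X'_0:Y'_0)$, and put $\rho^{(1)}=\mathcal F_0(\rho^{(0)})$, a state on $X'_1X\,Y'_1$; $\rho^{(i+1)}=\mathcal F_i\big(\mathcal N_{X\to Y}(\rho^{(i)})\big)$, a state on $X'_{i+1}X\,Y'_{i+1}$, for $1\le i<n$; and $\rho^{(n+1)}=\mathcal F_n\big(\mathcal N_{X\to Y}(\rho^{(n)})\big)$, a state on $X'_{n+1}Y'_{n+1}$, where $X'_{n+1}$ and $Y'_{n+1}$ are $k$-qubit systems. Here the $\mathcal F_i$ are quantum channels such that $\mathcal F_0$ maps $\mathrm{PPT}'(X'_0:Y'_0)$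 into $\mathrm{PPT}'(X'_1X:Y'_1)$, $\mathcal F_i$ maps $\mathrm{PPT}'(X'_i:YY'_i)$ into $\mathrm{PPT}'(X'_{i+1}X:Y'_{i+1})$ for $1\le i<n$, and $\mathcal F_n$ maps $\mathrm{PPT}'(X'_n:YY'_n)$ into $\mathrm{PPT}'(X'_{n+1}:Y'_{n+1})$. Assume $$\mathrm{tr}\big(\rho^{(n+1)}\,\Psi^{\otimes k}\big)\ge 1-\varepsilon,\qquad \Psi=|\Psi\rangle\langle\Psi|,\quad |\Psi\rangle=\tfrac1{\sqrt2}(|00\rangle+|11\rangle).$$ Then for every $\alpha\in(1,\infty)$ and every completely positive map $\mathcal M$ from $X$ to $Y$ with $\|\Theta_Y\circ\mathcal M\|_\diamond\le 1$ (where $\Theta_Y$ is the transpose map and $\|\cdot\|_\diamond$ the diamond norm), the limit defining $\widetilde D^{\mathrm{reg}}_\alpha(\mathcal N\|\mathcal M)$ exists in $[-\infty,\infty]$ and $$\frac kn\le \widetilde D^{\mathrm{reg}}_\alpha(\mathcal N\|\mathcal M)-\frac{\alpha}{n(\alpha-1)}\log(1-\varepsilon).$$ -/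

import Mathlib

open scoped ComplexOrder Kronecker

namespace QInfo

noncomputable section

/-! ## Operators and linear maps between operator spaces

A finite-dimensional system with a fixed orthonormal basis is a finite type `X`; the composite of
`X` and `Y` is `X × Y`. -/

/-- Linear operators on `ℂ^X`. -/
abbrev Op (X : Type*) := Matrix X X ℂ

/-- Linear maps from operators on `ℂ^X` to operators on `ℂ^Y`. -/
abbrev SuperOp (X Y : Type*) := Op X →ₗ[ℂ] Op Y

/-- Density operators: positive semidefinite of trace one. -/
def IsDensity {X : Type*} [Fintype X] (ρ : Op X) : Prop :=
  ρ.PosSemidef ∧ ρ.trace = 1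

/-- The map `id_R ⊗ N`: it applies `N` to every `X`-block of an operator on `R X`. -/
def idTensor (R : Type*) {X Y : Type*} (N : SuperOp X Y) : SuperOp (R × X) (R × Y) where
  toFun W := Matrix.of fun p q => N (Matrix.of fun x x' => W (p.1, x) (q.1, x')) p.2 q.2
  map_add' V W := by
    ext p q
    exact congrFun (congrFun (N.map_add (Matrix.of fun x x' => V (p.1, x) (q.1, x'))
      (Matrix.of fun x x' => W (p.1, x) (q.1, x'))) p.2) q.2
  map_smul' c W := by
    ext p q
    exact congrFun (congrFun (N.map_smul c (Matrix.of fun x x' => W (p.1, x) (q.1, x'))) p.2) q.2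

/-- The map `id_A ⊗ N ⊗ id_B`; the input is grouped as `A X : B` and the output as `A : Y B`
(the system on which `N` acts is handed over from the first party to the second). -/
def applyMiddle (A B : Type*) {X Y : Type*} (N : SuperOp X Y) :
    SuperOp ((A × X) × B) (A × (Y × B)) where
  toFun W := Matrix.of fun p q =>
    N (Matrix.of fun x x' => W ((p.1, x), p.2.2) ((q.1, x'), q.2.2)) p.2.1 q.2.1
  map_add' V W := by
    ext p q
    exact congrFun (congrFun (N.map_add
      (Matrix.of fun x x' => V ((p.1, x), p.2.2) ((q.1, x'), q.2.2))
      (Matrix.of fun x x' => W ((p.1, x), p.2.2) ((q.1, x'), q.2.2))) p.2.1) q.2.1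
  map_smul' c W := by
    ext p q
    exact congrFun (congrFun (N.map_smul c
      (Matrix.of fun x x' => W ((p.1, x), p.2.2) ((q.1, x'), q.2.2))) p.2.1) q.2.1

/-- The tensor power `N^{⊗ m}`, the linear map with
`⊗ᵢ |xᵢ⟩⟨xᵢ'| ↦ ⊗ᵢ N (|xᵢ⟩⟨xᵢ'|)`; the `m`-fold composite of `X` is `Fin m → X`. -/
def tensorPower {X Y : Type*} [Fintype X] [DecidableEq X] (N : SuperOp X Y) (m : ℕ) :
    SuperOp (Fin m → X) (Fin m → Y) where
  toFun W := Matrix.of fun y y' =>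
    ∑ x : Fin m → X, ∑ x' : Fin m → X,
      W x x' * ∏ i, N (Matrix.single (x i) (x' i) 1) (y i) (y' i)
  map_add' V W := by
    ext y y'
    simp [add_mul, Finset.sum_add_distrib]
  map_smul' c W := by
    ext y y'
    simp [mul_assoc, Finset.mul_sum]

/-- Complete positivity: all maps `id_R ⊗ N` preserve positive semidefiniteness. -/
def IsCompletelyPositive {X Y : Type*} (N : SuperOp X Y) : Prop :=
  ∀ (d : ℕ) (W : Op (Fin d × X)), W.PosSemidef → (idTensor (Fin d) N W).PosSemidef

/-- Quantum channels: completely positive trace-preserving maps. -/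
def IsChannel {X Y : Type*} [Fintype X] [Fintype Y] (N : SuperOp X Y) : Prop :=
  IsCompletelyPositive N ∧ ∀ W : Op X, (N W).trace = W.trace

/-! ## Norms, partial transpose, and the set `PPT'` -/

/-- The trace norm `‖W‖₁ = tr √(W* W)`, i.e. the sum of the singular values of `W`. -/
def traceNorm {X : Type*} [Fintype X] [DecidableEq X] (W : Op X) : ℝ :=
  ∑ i, √((Matrix.isHermitian_conjTranspose_mul_self W).eigenvalues i)

/-- The diamond norm `sup {‖(id_R ⊗ N)(W)‖₁ : ‖W‖₁ ≤ 1}`, over all finite-dimensional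
reference systems `R`. -/
def diamondNorm {X Y : Type*} [Fintype X] [DecidableEq X] [Fintype Y] [DecidableEq Y]
    (N : SuperOp X Y) : ENNReal :=
  ⨆ (d : ℕ) (W : Op (Fin d × X)) (_ : traceNorm W ≤ 1),
    ENNReal.ofReal (traceNorm (idTensor (Fin d) N W))

/-- The transpose map `Θ` on operators on `ℂ^Y`. -/
def transposeMap (Y : Type*) : SuperOp Y Y :=
  (Matrix.transposeLinearEquiv Y Y ℂ ℂ).toLinearMap

/-- The set `V_Θ` of completely positive maps `M` with `‖Θ ∘ M‖_⋄ ≤ 1`. -/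
def VTheta (X Y : Type*) [Fintype X] [DecidableEq X] [Fintype Y] [DecidableEq Y] :
    Set (SuperOp X Y) :=
  {M | IsCompletelyPositive M ∧ diamondNorm (transposeMap Y ∘ₗ M) ≤ 1}

/-- The partial transpose on the second system. -/
def partialTranspose {X Y : Type*} (W : Op (X × Y)) : Op (X × Y) :=
  Matrix.of fun p q => W (p.1, q.2) (q.1, p.2)

/-- `PPT'(X : Y)`: positive semidefinite operators on `X Y` whose partial transpose has trace norm
at most one. -/
def PPTPrime (X Y : Type*) [Fintype X] [DecidableEq X] [Fintype Y] [DecidableEq Y] :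
    Set (Op (X × Y)) :=
  {σ | σ.PosSemidef ∧ traceNorm (partialTranspose σ) ≤ 1}

/-- `F` maps elements of `PPT'(X : Y)` to elements of `PPT'(X₁ : Y₁)`. -/
def PreservesPPTPrime {X Y X₁ Y₁ : Type*} [Fintype X] [DecidableEq X] [Fintype Y] [DecidableEq Y]
    [Fintype X₁] [DecidableEq X₁] [Fintype Y₁] [DecidableEq Y₁]
    (F : SuperOp (X × Y) (X₁ × Y₁)) : Prop :=
  ∀ σ ∈ PPTPrime X Y, F σ ∈ PPTPrime X₁ Y₁

/-! ## The sandwiched Rényi divergence -/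

/-- The binary logarithm of a nonnegative real, with `log 0 = -∞`. -/
def log2 (x : ℝ) : EReal :=
  if x ≤ 0 then ⊥ else ((Real.logb 2 x : ℝ) : EReal)

/-- The power `W ^ s` of a positive semidefinite operator, by functional calculus. For `s < 0` this
is the generalized inverse power, since `(0 : ℝ) ^ s = 0` for `s ≠ 0`. -/
def opPow {X : Type*} [Fintype X] [DecidableEq X] (W : Op X) (s : ℝ) : Op X :=
  cfc (fun t : ℝ => t ^ s) W

/-- `supp ρ ⊆ supp σ`, where the support is the orthogonal complement of the kernel. -/
def SuppLE {X : Type*} [Fintype X] (ρ σ : Op X) : Prop :=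
  ∀ v : X → ℂ, σ.mulVec v = 0 → ρ.mulVec v = 0

open Classical in
/-- The sandwiched Rényi divergence of positive semidefinite operators, for `1 < α`. -/
def sandwichedDiv {X : Type*} [Fintype X] [DecidableEq X] (α : ℝ) (ρ σ : Op X) : EReal :=
  if SuppLE ρ σ then
    ((1 / (α - 1) : ℝ) : EReal) *
      log2 (opPow (opPow σ ((1 - α) / (2 * α)) * ρ * opPow σ ((1 - α) / (2 * α))) α).trace.re
  else ⊤

/-- The unnormalized maximally entangled operator `∑ |x⟩⟨x'| ⊗ |x⟩⟨x'|`. -/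
def unnormMaxEnt (X : Type*) [DecidableEq X] : Op (X × X) :=
  Matrix.of fun p q => if p.1 = p.2 ∧ q.1 = q.2 then 1 else 0

/-- The Choi operator of `N`. -/
def choi {X Y : Type*} [DecidableEq X] (N : SuperOp X Y) : Op (X × Y) :=
  idTensor X N (unnormMaxEnt X)

/-- The channel divergence: the supremum over density operators `ω` on the input system of the
divergence of `ω^{1/2} J^N ω^{1/2}` and `ω^{1/2} J^M ω^{1/2}`. -/
def channelDiv {X Y : Type*} [Fintype X] [DecidableEq X] [Fintype Y] [DecidableEq Y]
    (α : ℝ) (N M : SuperOp X Y) : EReal :=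
  ⨆ (ω : Op X) (_ : IsDensity ω),
    sandwichedDiv α
      ((opPow ω (1 / 2) ⊗ₖ (1 : Op Y)) * choi N * (opPow ω (1 / 2) ⊗ₖ (1 : Op Y)))
      ((opPow ω (1 / 2) ⊗ₖ (1 : Op Y)) * choi M * (opPow ω (1 / 2) ⊗ₖ (1 : Op Y)))

/-- The `m`-copy rate `(1/m) D(N^{⊗ m} ‖ M^{⊗ m})`. -/
def channelDivRate {X Y : Type*} [Fintype X] [DecidableEq X] [Fintype Y] [DecidableEq Y]
    (α : ℝ) (N M : SuperOp X Y) (m : ℕ) : EReal :=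
  channelDiv α (tensorPower N m) (tensorPower M m) / (m : EReal)

/-- The regularized channel divergence `lim_{m → ∞} (1/m) D(N^{⊗ m} ‖ M^{⊗ m})`. -/
def regChannelDiv {X Y : Type*} [Fintype X] [DecidableEq X] [Fintype Y] [DecidableEq Y]
    (α : ℝ) (N M : SuperOp X Y) : EReal :=
  Filter.limUnder Filter.atTop (channelDivRate α N M)

/-! ## Protocols -/

/-- A `PPT'`-assisted protocol with `n ≥ 1` uses of `N`. The first party holds `A i` and the second
party holds `B i`; `ρ i` is the state just before the `i`-th use of `N`, for `1 ≤ i ≤ n`.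
The maps `F₀ = first`, `Fᵢ = mid i` for `1 ≤ i < n`, and `Fₙ = last` are channels that map
`PPT'` to `PPT'` across the cut between the two parties; the systems held at the end
are `A'` and `B'`. Only the entries of `mid` and `ρ` with indices in these ranges matter. -/
structure PPTProtocol {X Y : Type*} [Fintype X] [DecidableEq X] [Fintype Y] [DecidableEq Y]
    (N : SuperOp X Y) (n : ℕ) (A B : ℕ → Type*)
    [∀ i, Fintype (A i)] [∀ i, DecidableEq (A i)] [∀ i, Fintype (B i)] [∀ i, DecidableEq (B i)]
    (A' B' : Type*) [Fintype A'] [DecidableEq A'] [Fintype B'] [DecidableEq B'] where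
  init : Op (A 0 × B 0)
  init_density : IsDensity init
  init_ppt : init ∈ PPTPrime (A 0) (B 0)
  first : SuperOp (A 0 × B 0) ((A 1 × X) × B 1)
  first_channel : IsChannel first
  first_ppt : PreservesPPTPrime first
  mid : ∀ i, SuperOp (A i × (Y × B i)) ((A (i + 1) × X) × B (i + 1))
  mid_channel : ∀ i, 1 ≤ i → i < n → IsChannel (mid i)
  mid_ppt : ∀ i, 1 ≤ i → i < n → PreservesPPTPrime (mid i)
  last : SuperOp (A n × (Y × B n)) (A' × B')
  last_channel : IsChannel last
  last_ppt : PreservesPPTPrime last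
  ρ : ∀ i, Op ((A i × X) × B i)
  ρ_one : ρ 1 = first init
  ρ_succ : ∀ i, 1 ≤ i → i < n → ρ (i + 1) = mid i (applyMiddle (A i) (B i) N (ρ i))

/-- The state on `A' B'` at the end of the protocol. -/
def PPTProtocol.output {X Y : Type*} [Fintype X] [DecidableEq X] [Fintype Y] [DecidableEq Y]
    {N : SuperOp X Y} {n : ℕ} {A B : ℕ → Type*}
    [∀ i, Fintype (A i)] [∀ i, DecidableEq (A i)] [∀ i, Fintype (B i)] [∀ i, DecidableEq (B i)]
    {A' B' : Type*} [Fintype A'] [DecidableEq A'] [Fintype B'] [DecidableEq B']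
    (P : PPTProtocol N n A B A' B') : Op (A' × B') :=
  P.last (applyMiddle (A n) (B n) N (P.ρ n))

/-- The vector `(|00⟩ + |11⟩)/√2`. -/
def bellVec : Fin 2 × Fin 2 → ℂ := fun p => if p.1 = p.2 then ((1 / √2 : ℝ) : ℂ) else 0

/-- The maximally entangled two-qubit state. -/
def bellState : Op (Fin 2 × Fin 2) := Matrix.vecMulVec bellVec (star bellVec)

/-- The state `Ψ^{⊗ k}`, on two `k`-qubit systems. -/
def bellPower (k : ℕ) : Op ((Fin k → Fin 2) × (Fin k → Fin 2)) :=
  Matrix.of fun p q => ∏ i, bellState (p.1 i, p.2 i) (q.1 i, q.2 i)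

end

end QInfo

/-! Run the protocol a second time with `M` in place of `N`, starting from the same state `ρ 1`. The
bound on `Θ ∘ M` keeps the comparison operators in `PPT'` (`applyMiddle_mem_PPTPrime`), so the final
one has overlap at most `2 ^ (-k)` with `k` Bell pairs (`trace_mul_bellPower_le`), while the true
output has overlap at least `1 - ε`. It remains to see how far `n` uses of the maps can separate the
two runs.

This needs a chain rule: one use of the pair `N`, `M` raises the divergence by at most the
regularized channel divergence. It is proved for `m` copies at the level of classical Rényi sums of
measurement outcomes (`MeasuredBound.step`). The operator `σ^{⊗m}` has only polynomially many
distinct eigenvalues, so by pinching `ρ^{⊗m}` is at most a polynomial in `m` times its diagonal part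
in an eigenbasis of `σ^{⊗m}`. Joint subadditivity of `p ^ α q ^ (1 - α)` then splits the Rényi sum
into an outer factor, which is a measurement of the previous pair, and an inner factor, in which
both maps act on the same pure input. The inner factor is controlled by the `m`-copy channel
divergence: a polar decomposition turns the input into `ω^{1/2}` followed by a contraction
(`measuredSum_applyMiddle_le`), and measurements do not increase the sandwiched divergence
(`measuredSum_le_sandwichedQ`, by pinching again and the tensor-power trick).

Testing all `m` copies of the output against Bell pairs gives an inequality between exponentials in
`m` up to a polynomial factor (`PPTProtocol.exists_log_bound`). Taking logarithms and dividing by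
`m` removes the polynomial as `m → ∞`. The limit exists by Fekete's lemma, since product inputs make
the `m`-copy divergences superadditive. -/

namespace QInfo

open Matrix

/-! ## Diagonalizations and functional calculus -/

/-- `W = U diag(d) Uᴴ` with `U` unitary, where the eigenvectors are labelled by `J`. -/
structure Diagonalizes {X J : Type*} [Fintype X] [DecidableEq X] [Fintype J] [DecidableEq J]
    (U : Matrix X J ℂ) (d : J → ℝ) (W : Op X) : Prop where
  mul_conjTranspose_self : U * Uᴴ = 1
  conjTranspose_mul_self : Uᴴ * U = 1
  eq : W = U * diagonal (fun j => (d j : ℂ)) * Uᴴ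

section Diagonalizes

variable {X J X' J' : Type*} [Fintype X] [DecidableEq X] [Fintype J] [DecidableEq J]
  [Fintype X'] [DecidableEq X'] [Fintype J'] [DecidableEq J']

theorem diagonalizes_of_isHermitian {W : Op X} (hW : W.IsHermitian) :
    Diagonalizes (hW.eigenvectorUnitary : Matrix X X ℂ) hW.eigenvalues W where
  mul_conjTranspose_self := Unitary.coe_mul_star_self _
  conjTranspose_mul_self := Unitary.coe_star_mul_self _
  eq := by
    conv_lhs => rw [hW.spectral_theorem, Unitary.conjStarAlgAut_apply]
    rfl

theorem Diagonalizes.isHermitian {U : Matrix X J ℂ} {d : J → ℝ} {W : Op X}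
    (h : Diagonalizes U d W) : W.IsHermitian := by
  rw [h.eq, IsHermitian]
  simp [diagonal_conjTranspose, Matrix.mul_assoc, Pi.star_def]

theorem Diagonalizes.conj_eq {U : Matrix X J ℂ} {d : J → ℝ} {W : Op X}
    (h : Diagonalizes U d W) : Uᴴ * W * U = diagonal (fun j => (d j : ℂ)) := by
  rw [h.eq]
  calc Uᴴ * (U * diagonal (fun j => (d j : ℂ)) * Uᴴ) * U
      = (Uᴴ * U) * diagonal (fun j => (d j : ℂ)) * (Uᴴ * U) := by simp only [Matrix.mul_assoc]
    _ = _ := by rw [h.conjTranspose_mul_self]; simp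

theorem Diagonalizes.posSemidef {U : Matrix X J ℂ} {d : J → ℝ} {W : Op X}
    (h : Diagonalizes U d W) (hd : ∀ j, 0 ≤ d j) : W.PosSemidef := by
  rw [h.eq]
  refine PosSemidef.mul_mul_conjTranspose_same (PosSemidef.diagonal fun j => ?_) U
  simpa using hd j

theorem Diagonalizes.nonneg {U : Matrix X J ℂ} {d : J → ℝ} {W : Op X}
    (h : Diagonalizes U d W) (hW : W.PosSemidef) (j : J) : 0 ≤ d j := by
  have := hW.conjTranspose_mul_mul_same U
  rw [h.conj_eq, posSemidef_diagonal_iff] at this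
  simpa using this j

/-- Let `V` be the eigenvector matrix chosen by Mathlib. `Vᴴ U` intertwines the two diagonal
matrices, so its entries vanish unless the eigenvalues agree; hence it also intertwines their images
under `f`. This frees the functional calculus from a canonical eigenbasis, so that tensor-product
bases can be used. -/
theorem Diagonalizes.cfc_eq {U : Matrix X J ℂ} {d : J → ℝ} {W : Op X}
    (h : Diagonalizes U d W) (f : ℝ → ℝ) : Diagonalizes U (fun j => f (d j)) (cfc f W) where
  mul_conjTranspose_self := h.mul_conjTranspose_self
  conjTranspose_mul_self := h.conjTranspose_mul_self
  eq := by
    have hW := h.isHermitian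
    obtain ⟨V1, V2, hV⟩ := diagonalizes_of_isHermitian hW
    rw [hW.cfc_eq, IsHermitian.cfc, Unitary.conjStarAlgAut_apply]
    set V : Matrix X X ℂ := (hW.eigenvectorUnitary : Matrix X X ℂ)
    change V * diagonal (fun i => ((f (hW.eigenvalues i) : ℝ) : ℂ)) * Vᴴ = _
    have key : diagonal (fun i => ((hW.eigenvalues i : ℝ) : ℂ)) * (Vᴴ * U)
        = (Vᴴ * U) * diagonal (fun j => (d j : ℂ)) := by
      have e : V * diagonal (fun i => ((hW.eigenvalues i : ℝ) : ℂ)) * Vᴴ =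
        U * diagonal (fun j => (d j : ℂ)) * Uᴴ := hV.symm.trans h.eq
      calc diagonal (fun i => ((hW.eigenvalues i : ℝ) : ℂ)) * (Vᴴ * U)
          = (Vᴴ * V) * diagonal (fun i => ((hW.eigenvalues i : ℝ) : ℂ)) * (Vᴴ * U) := by
            rw [V2, Matrix.one_mul]
        _ = Vᴴ * (V * diagonal (fun i => ((hW.eigenvalues i : ℝ) : ℂ)) * Vᴴ) * U := by
            simp only [Matrix.mul_assoc]
        _ = (Vᴴ * U) * diagonal (fun j => (d j : ℂ)) * (Uᴴ * U) := by
            rw [e]; simp only [Matrix.mul_assoc]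
        _ = _ := by rw [h.conjTranspose_mul_self, Matrix.mul_one]
    have key2 : diagonal (fun i => ((f (hW.eigenvalues i) : ℝ) : ℂ)) * (Vᴴ * U)
        = (Vᴴ * U) * diagonal (fun j => (f (d j) : ℂ)) := by
      ext i j
      have := congrFun (congrFun key i) j
      rw [diagonal_mul, mul_diagonal] at this ⊢
      by_cases hz : (Vᴴ * U) i j = 0
      · rw [hz]; simp
      · rw [mul_comm] at this
        have := mul_left_cancel₀ hz this
        rw [Complex.ofReal_inj.1 this, mul_comm]
    calc V * diagonal (fun i => ((f (hW.eigenvalues i) : ℝ) : ℂ)) * Vᴴ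
        = V * (diagonal (fun i => ((f (hW.eigenvalues i) : ℝ) : ℂ)) * (Vᴴ * U)) * Uᴴ := by
          simp only [Matrix.mul_assoc, h.mul_conjTranspose_self, Matrix.mul_one]
      _ = (V * Vᴴ) * U * diagonal (fun j => (f (d j) : ℂ)) * Uᴴ := by
          rw [key2]; simp only [Matrix.mul_assoc]
      _ = _ := by rw [V1, Matrix.one_mul]

theorem Diagonalizes.opPow {U : Matrix X J ℂ} {d : J → ℝ} {W : Op X}
    (h : Diagonalizes U d W) (s : ℝ) : Diagonalizes U (fun j => d j ^ s) (opPow W s) := by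
  unfold QInfo.opPow
  exact h.cfc_eq fun t => t ^ s

theorem Diagonalizes.trace {U : Matrix X J ℂ} {d : J → ℝ} {W : Op X}
    (h : Diagonalizes U d W) : W.trace = ∑ j, (d j : ℂ) := by
  rw [h.eq, Matrix.trace_mul_comm, ← Matrix.mul_assoc, h.conjTranspose_mul_self, Matrix.one_mul,
    trace_diagonal]

theorem Diagonalizes.kronecker {U : Matrix X J ℂ} {d : J → ℝ} {W : Op X}
    (h : Diagonalizes U d W) {U' : Matrix X' J' ℂ} {d' : J' → ℝ} {W' : Op X'}
    (h' : Diagonalizes U' d' W') :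
    Diagonalizes (U ⊗ₖ U') (fun p => d p.1 * d' p.2) (W ⊗ₖ W') where
  mul_conjTranspose_self := by
    rw [conjTranspose_kronecker, ← mul_kronecker_mul, h.mul_conjTranspose_self,
      h'.mul_conjTranspose_self, one_kronecker_one]
  conjTranspose_mul_self := by
    rw [conjTranspose_kronecker, ← mul_kronecker_mul, h.conjTranspose_mul_self,
      h'.conjTranspose_mul_self, one_kronecker_one]
  eq := by
    rw [h.eq, h'.eq, conjTranspose_kronecker, mul_kronecker_mul, mul_kronecker_mul,
      diagonal_kronecker_diagonal]
    simp

theorem Diagonalizes.submatrix {U : Matrix X J ℂ} {d : J → ℝ} {W : Op X}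
    (h : Diagonalizes U d W) (e : X' ≃ X) :
    Diagonalizes (U.submatrix e id) d (W.submatrix e e) where
  mul_conjTranspose_self := by
    rw [conjTranspose_submatrix, ← submatrix_mul U Uᴴ e id e Function.bijective_id,
      h.mul_conjTranspose_self, submatrix_one_equiv]
  conjTranspose_mul_self := by
    rw [conjTranspose_submatrix, submatrix_mul_equiv Uᴴ U id e id, h.conjTranspose_mul_self,
      submatrix_id_id]
  eq := by
    conv_lhs => rw [h.eq]
    rw [conjTranspose_submatrix]
    rfl

theorem opPow_isHermitian {W : Op X} (hW : W.IsHermitian) (s : ℝ) : (opPow W s).IsHermitian :=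
  ((diagonalizes_of_isHermitian hW).opPow s).isHermitian

theorem opPow_posSemidef {W : Op X} (hW : W.PosSemidef) (s : ℝ) : (opPow W s).PosSemidef :=
  ((diagonalizes_of_isHermitian hW.1).opPow s).posSemidef fun j =>
    Real.rpow_nonneg (hW.eigenvalues_nonneg j) s

theorem opPow_kronecker {W : Op X} (hW : W.PosSemidef) {W' : Op X'} (hW' : W'.PosSemidef)
    (s : ℝ) : opPow (W ⊗ₖ W') s = opPow W s ⊗ₖ opPow W' s := by
  have h := diagonalizes_of_isHermitian hW.1
  have h' := diagonalizes_of_isHermitian hW'.1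
  rw [((h.kronecker h').opPow s).eq, ((h.opPow s).kronecker (h'.opPow s)).eq]
  congr 3
  ext p
  rw [Real.mul_rpow (hW.eigenvalues_nonneg _) (hW'.eigenvalues_nonneg _)]

theorem opPow_submatrix {W : Op X} (hW : W.IsHermitian) (e : X' ≃ X) (s : ℝ) :
    opPow (W.submatrix e e) s = (opPow W s).submatrix e e := by
  have h := diagonalizes_of_isHermitian hW
  rw [((h.submatrix e).opPow s).eq, ((h.opPow s).submatrix e).eq]

/-- The case `s + t = 0` must be excluded: there the product is the support projection if `s ≠ 0`,
whereas `opPow W 0 = 1` because `0 ^ 0 = 1`. -/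
theorem opPow_mul_opPow {W : Op X} (hW : W.PosSemidef) {s t : ℝ} (hst : s + t ≠ 0) :
    opPow W s * opPow W t = opPow W (s + t) := by
  have h := diagonalizes_of_isHermitian hW.1
  set U : Matrix X X ℂ := (hW.1.eigenvectorUnitary : Matrix X X ℂ)
  rw [(h.opPow s).eq, (h.opPow t).eq, (h.opPow (s + t)).eq]
  calc U * diagonal (fun j => ((hW.1.eigenvalues j ^ s : ℝ) : ℂ)) * Uᴴ *
        (U * diagonal (fun j => ((hW.1.eigenvalues j ^ t : ℝ) : ℂ)) * Uᴴ)
      = U * (diagonal (fun j => ((hW.1.eigenvalues j ^ s : ℝ) : ℂ)) * (Uᴴ * U) *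
          diagonal (fun j => ((hW.1.eigenvalues j ^ t : ℝ) : ℂ))) * Uᴴ := by
        simp only [Matrix.mul_assoc]
    _ = _ := by
        rw [h.conjTranspose_mul_self, Matrix.mul_one, diagonal_mul_diagonal]
        congr 3
        ext j
        rw [Real.rpow_add' (hW.eigenvalues_nonneg j) hst]
        push_cast
        rfl

theorem opPow_one {W : Op X} (hW : W.IsHermitian) : opPow W 1 = W := by
  have h := diagonalizes_of_isHermitian hW
  rw [(h.opPow 1).eq]
  simp only [Real.rpow_one]
  exact h.eq.symm

/-- The support projection of a positive semidefinite operator, written as `W^s W^{-s}`. -/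
theorem mul_opPow_mul_opPow_neg {W : Op X} (hW : W.PosSemidef) (s : ℝ) :
    W * (opPow W s * opPow W (-s)) = W := by
  have h := diagonalizes_of_isHermitian hW.1
  set U : Matrix X X ℂ := (hW.1.eigenvectorUnitary : Matrix X X ℂ)
  have e : W * (opPow W s * opPow W (-s)) =
      U * (diagonal (fun j => (hW.1.eigenvalues j : ℂ)) * (Uᴴ * U) *
        diagonal (fun j => ((hW.1.eigenvalues j ^ s : ℝ) : ℂ)) * (Uᴴ * U) *
          diagonal (fun j => ((hW.1.eigenvalues j ^ (-s) : ℝ) : ℂ))) * Uᴴ := by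
    rw [(h.opPow s).eq, (h.opPow (-s)).eq]
    conv_lhs => enter [1]; rw [h.eq]
    simp only [Matrix.mul_assoc]
  rw [e, h.conjTranspose_mul_self, Matrix.mul_one, Matrix.mul_one, diagonal_mul_diagonal,
    diagonal_mul_diagonal]
  conv_rhs => rw [h.eq]
  congr 3
  ext j
  rcases (hW.eigenvalues_nonneg j).eq_or_lt with h0 | h0
  · rw [← h0]; simp
  · rw [mul_assoc, ← Complex.ofReal_mul, ← Real.rpow_add h0]; simp

theorem one_sub_support_posSemidef {W : Op X} (hW : W.PosSemidef) {s : ℝ} (hs : s ≠ 0) :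
    (1 - opPow W s * opPow W (-s)).PosSemidef := by
  have h := diagonalizes_of_isHermitian hW.1
  set U : Matrix X X ℂ := (hW.1.eigenvectorUnitary : Matrix X X ℂ)
  have : 1 - opPow W s * opPow W (-s) = U * diagonal (fun j =>
      ((1 - hW.1.eigenvalues j ^ s * hW.1.eigenvalues j ^ (-s) : ℝ) : ℂ)) * Uᴴ := by
    have e : opPow W s * opPow W (-s) =
      U * (diagonal (fun j => ((hW.1.eigenvalues j ^ s : ℝ) : ℂ)) * (Uᴴ * U) *
          diagonal (fun j => ((hW.1.eigenvalues j ^ (-s) : ℝ) : ℂ))) * Uᴴ := by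
      rw [(h.opPow s).eq, (h.opPow (-s)).eq]
      simp only [Matrix.mul_assoc]
    rw [e, h.conjTranspose_mul_self, Matrix.mul_one, diagonal_mul_diagonal,
      ← h.mul_conjTranspose_self]
    have : diagonal (fun j =>
      ((1 - hW.1.eigenvalues j ^ s * hW.1.eigenvalues j ^ (-s) : ℝ) : ℂ)) = 1 -
        diagonal (fun j => ((hW.1.eigenvalues j ^ s : ℝ) : ℂ) *
          ((hW.1.eigenvalues j ^ (-s) : ℝ) : ℂ)) := by
      rw [← diagonal_one, diagonal_sub]
      congr 1
      ext j
      push_cast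
      rfl
    rw [this, Matrix.mul_sub, Matrix.sub_mul, Matrix.mul_one]
  rw [this]
  refine PosSemidef.mul_mul_conjTranspose_same (PosSemidef.diagonal fun j => ?_) U
  refine Complex.zero_le_real.2 ?_
  rcases (hW.eigenvalues_nonneg j).eq_or_lt with h0 | h0
  · rw [← h0, Real.zero_rpow hs]; simp
  · rw [← Real.rpow_add h0]; simp

end Diagonalizes

/-! ## Tensor products of families of matrices -/

/-- The tensor product `⊗ᵢ A i` of a family of matrices. -/
def piTensor {ι X Y : Type*} [Fintype ι] (A : ι → Matrix Y X ℂ) : Matrix (ι → Y) (ι → X) ℂ :=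
  of fun y x => ∏ i, A i (y i) (x i)

section PiTensor

variable {ι X Y Z : Type*} [Fintype ι] [DecidableEq ι]

theorem piTensor_mul [Fintype Y] (A : ι → Matrix Z Y ℂ) (B : ι → Matrix Y X ℂ) :
    piTensor A * piTensor B = piTensor fun i => A i * B i := by
  ext z x
  simp only [piTensor, Matrix.mul_apply, of_apply, ← Finset.prod_mul_distrib]
  rw [Finset.prod_univ_sum, Fintype.piFinset_univ]

omit [DecidableEq ι] in
theorem piTensor_one [DecidableEq X] : piTensor (fun _ : ι => (1 : Op X)) = 1 := by
  ext x y
  simp only [piTensor, of_apply, one_apply]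
  by_cases h : x = y
  · simp [h]
  · rw [if_neg h]
    obtain ⟨i, hi⟩ := Function.ne_iff.1 h
    exact Finset.prod_eq_zero (Finset.mem_univ i) (by simp [hi])

omit [DecidableEq ι] in
theorem conjTranspose_piTensor (A : ι → Matrix Y X ℂ) :
    (piTensor A)ᴴ = piTensor fun i => (A i)ᴴ := by
  ext x y
  simp [piTensor, conjTranspose_apply]

theorem trace_piTensor [Fintype X] (A : ι → Op X) : (piTensor A).trace = ∏ i, (A i).trace := by
  simp only [trace, diag_apply, piTensor, of_apply]
  rw [Finset.prod_univ_sum, Fintype.piFinset_univ]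

theorem PosSemidef.exists_conjTranspose_mul [Fintype X] {W : Op X}
    (hW : W.PosSemidef) : ∃ B : Op X, W = Bᴴ * B := by
  classical
  refine ⟨opPow W (1 / 2), ?_⟩
  rw [(opPow_isHermitian hW.1 _).eq, opPow_mul_opPow hW (by norm_num)]
  norm_num [opPow_one hW.1]

theorem piTensor_posSemidef [Finite X] {A : ι → Op X} (hA : ∀ i, (A i).PosSemidef) :
    (piTensor A).PosSemidef := by
  cases nonempty_fintype X
  choose B hB using fun i => PosSemidef.exists_conjTranspose_mul (hA i)
  have : A = fun i => (B i)ᴴ * B i := funext hB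
  rw [this, ← piTensor_mul, ← conjTranspose_piTensor]
  exact posSemidef_conjTranspose_mul_self _

theorem Diagonalizes.piTensor [Fintype X] [DecidableEq X] [Fintype Y] [DecidableEq Y]
    {U : Matrix X Y ℂ} {d : Y → ℝ} {W : Op X} (h : Diagonalizes U d W) :
    Diagonalizes (piTensor fun _ : ι => U) (fun y => ∏ i, d (y i)) (piTensor fun _ : ι => W) where
  mul_conjTranspose_self := by
    rw [conjTranspose_piTensor, piTensor_mul, h.mul_conjTranspose_self, piTensor_one]
  conjTranspose_mul_self := by
    rw [conjTranspose_piTensor, piTensor_mul, h.conjTranspose_mul_self, piTensor_one]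
  eq := by
    have : diagonal (fun y : ι → Y => ((∏ i, d (y i) : ℝ) : ℂ)) =
        QInfo.piTensor fun _ : ι => diagonal fun j => (d j : ℂ) := by
      ext x y
      simp only [QInfo.piTensor, of_apply, diagonal_apply]
      by_cases h : x = y
      · simp [h]
      · rw [if_neg h]
        obtain ⟨i, hi⟩ := Function.ne_iff.1 h
        exact (Finset.prod_eq_zero (Finset.mem_univ i) (by simp [hi])).symm
    rw [this, conjTranspose_piTensor, piTensor_mul, piTensor_mul, ← h.eq]

theorem opPow_piTensor [Fintype X] [DecidableEq X] {W : Op X} (hW : W.PosSemidef) (s : ℝ) :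
    opPow (piTensor fun _ : ι => W) s = piTensor fun _ : ι => opPow W s := by
  have h := diagonalizes_of_isHermitian hW.1
  rw [((h.piTensor (ι := ι)).opPow s).eq, ((h.opPow s).piTensor (ι := ι)).eq]
  congr 3
  ext p
  rw [Real.finsetProd_rpow _ _ fun i _ => hW.eigenvalues_nonneg _]

end PiTensor

/-! ## Kraus decompositions and tensor powers of maps -/

section Maps

variable {X Y Z : Type*}

theorem superOp_apply_eq_sum [Fintype X] [DecidableEq X] (N : SuperOp X Y) (W : Op X) (y y' : Y) :
    N W y y' = ∑ x, ∑ x', W x x' * N (single x x' 1) y y' := by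
  conv_lhs => rw [matrix_eq_sum_single W]
  simp only [map_sum, Matrix.sum_apply]
  refine Finset.sum_congr rfl fun x _ => Finset.sum_congr rfl fun x' _ => ?_
  have : single x x' (W x x') = W x x' • single x x' (1 : ℂ) := by simp
  rw [this, map_smul, Matrix.smul_apply, smul_eq_mul]

theorem choi_apply [DecidableEq X] (N : SuperOp X Y) (p q : X × Y) :
    choi N p q = N (single p.1 q.1 1) p.2 q.2 := by
  change N (of fun x x' => unnormMaxEnt X (p.1, x) (q.1, x')) p.2 q.2 = _
  congr 3

theorem tensorPower_apply [Fintype X] [DecidableEq X] (N : SuperOp X Y) (m : ℕ)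
    (W : Op (Fin m → X)) (y y' : Fin m → Y) : tensorPower N m W y y' =
      ∑ x : Fin m → X, ∑ x' : Fin m → X,
        W x x' * ∏ i, N (single (x i) (x' i) 1) (y i) (y' i) := rfl

theorem single_eq_piTensor [DecidableEq X] {m : ℕ} (x x' : Fin m → X) :
    single x x' (1 : ℂ) = piTensor fun i => single (x i) (x' i) 1 := by
  ext y y'
  simp only [piTensor, of_apply, single_apply]
  by_cases h : x = y ∧ x' = y'
  · rw [if_pos h, h.1, h.2]; simp
  · rw [if_neg h]
    have : ∃ i, ¬(x i = y i ∧ x' i = y' i) := by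
      by_contra hc
      push Not at hc
      exact h ⟨funext fun i => (hc i).1, funext fun i => (hc i).2⟩
    obtain ⟨i, hi⟩ := this
    exact (Finset.prod_eq_zero (Finset.mem_univ i) (if_neg hi)).symm

theorem tensorPower_piTensor [Fintype X] [DecidableEq X] (N : SuperOp X Y) {m : ℕ}
    (W : Fin m → Op X) : tensorPower N m (piTensor W) = piTensor fun i => N (W i) := by
  ext y y'
  rw [tensorPower_apply]
  simp only [piTensor, of_apply]
  simp_rw [superOp_apply_eq_sum N (W _), Finset.prod_univ_sum, Fintype.piFinset_univ,
    Finset.prod_mul_distrib]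

theorem tensorPower_single [Fintype X] [DecidableEq X] (N : SuperOp X Y) {m : ℕ}
    (x x' : Fin m → X) :
    tensorPower N m (single x x' 1) = piTensor fun i => N (single (x i) (x' i) 1) := by
  rw [single_eq_piTensor, tensorPower_piTensor]

theorem superOp_ext [Fintype X] [DecidableEq X] {N M : SuperOp X Y}
    (h : ∀ x x', N (single x x' 1) = M (single x x' 1)) : N = M := by
  ext W y y'
  rw [superOp_apply_eq_sum N, superOp_apply_eq_sum M]
  simp only [h]

theorem trace_superOp_eq [Fintype X] [DecidableEq X] [Fintype Y] {F : SuperOp X Y}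
    (h : ∀ x x', (F (single x x' 1)).trace = (single x x' (1 : ℂ)).trace) (W : Op X) :
    (F W).trace = W.trace := by
  rw [matrix_eq_sum_single W]
  simp only [map_sum, trace_sum]
  refine Finset.sum_congr rfl fun x _ => Finset.sum_congr rfl fun x' _ => ?_
  have : single x x' (W x x') = W x x' • single x x' (1 : ℂ) := by simp
  rw [this, map_smul, trace_smul, trace_smul, h]

theorem trace_tensorPower [Fintype X] [DecidableEq X] [Fintype Y] {F : SuperOp X Y}
    (hF : ∀ W, (F W).trace = W.trace) (m : ℕ) (W : Op (Fin m → X)) :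
    (tensorPower F m W).trace = W.trace :=
  trace_superOp_eq (fun x x' => by
    rw [tensorPower_single, single_eq_piTensor, trace_piTensor, trace_piTensor]
    simp only [hF]) W

/-- The map `W ↦ ∑ₖ Aₖ W Aₖᴴ`. -/
def krausMap {κ : Type*} [Fintype κ] [Fintype X] (A : κ → Matrix Y X ℂ) : SuperOp X Y where
  toFun W := ∑ k, A k * W * (A k)ᴴ
  map_add' V W := by simp [Matrix.mul_add, Matrix.add_mul, Finset.sum_add_distrib]
  map_smul' c W := by simp [Finset.smul_sum]

/-- `N` has a Kraus decomposition. -/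
def HasKraus [Fintype X] (N : SuperOp X Y) : Prop :=
  ∃ (r : ℕ) (A : Fin r → Matrix Y X ℂ), N = krausMap A

theorem krausMap_apply {κ : Type*} [Fintype κ] [Fintype X] (A : κ → Matrix Y X ℂ) (W : Op X) :
    krausMap A W = ∑ k, A k * W * (A k)ᴴ := rfl

theorem hasKraus_krausMap {κ : Type*} [Fintype κ] [Fintype X] (A : κ → Matrix Y X ℂ) :
    HasKraus (krausMap A) := by
  refine ⟨Fintype.card κ, fun k => A ((Fintype.equivFin κ).symm k), ?_⟩
  ext1 W
  rw [krausMap_apply, krausMap_apply,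
    (Fintype.equivFin κ).symm.sum_comp fun k => A k * W * (A k)ᴴ]

theorem HasKraus.posSemidef [Fintype X] [Fintype Y] {N : SuperOp X Y} (hN : HasKraus N)
    {W : Op X} (hW : W.PosSemidef) : (N W).PosSemidef := by
  obtain ⟨r, A, rfl⟩ := hN
  exact posSemidef_sum _ fun k _ => hW.mul_mul_conjTranspose_same (A k)

theorem HasKraus.comp [Fintype X] [Fintype Y] {F : SuperOp Y Z} {G : SuperOp X Y}
    (hF : HasKraus F) (hG : HasKraus G) : HasKraus (F ∘ₗ G) := by
  obtain ⟨r, A, rfl⟩ := hF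
  obtain ⟨s, B, rfl⟩ := hG
  have : krausMap A ∘ₗ krausMap B = krausMap fun k : Fin r × Fin s => A k.1 * B k.2 := by
    ext1 W
    simp only [LinearMap.comp_apply, krausMap_apply, Fintype.sum_prod_type, Matrix.mul_sum,
      Matrix.sum_mul, conjTranspose_mul, Matrix.mul_assoc]
  rw [this]
  exact hasKraus_krausMap _

/-- Expanding the product of the `m` Kraus sums gives one Kraus operator, a tensor product, for each
choice of an index in every factor. -/
theorem HasKraus.tensorPower [Fintype X] [DecidableEq X] {N : SuperOp X Y} (hN : HasKraus N)
    (m : ℕ) : HasKraus (tensorPower N m) := by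
  obtain ⟨r, A, rfl⟩ := hN
  have : QInfo.tensorPower (krausMap A) m =
      krausMap fun k : Fin m → Fin r => piTensor fun i => A (k i) := by
    refine superOp_ext fun x x' => ?_
    rw [tensorPower_single, krausMap_apply]
    simp only [single_eq_piTensor, conjTranspose_piTensor, piTensor_mul, krausMap_apply]
    ext y y'
    simp only [piTensor, of_apply, Matrix.sum_apply]
    rw [Finset.prod_univ_sum, Fintype.piFinset_univ]
  rw [this]
  exact hasKraus_krausMap _

theorem idTensor_submatrix {R R' : Type*} (e : R' → R) (N : SuperOp X Y) (W : Op (R × X)) :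
    idTensor R' N (W.submatrix (Prod.map e id) (Prod.map e id)) =
      (idTensor R N W).submatrix (Prod.map e id) (Prod.map e id) := rfl

theorem posSemidef_unnormMaxEnt (X : Type*) [Fintype X] [DecidableEq X] :
    (unnormMaxEnt X).PosSemidef := by
  have : unnormMaxEnt X = vecMulVec (fun p : X × X => if p.1 = p.2 then (1 : ℂ) else 0)
      (star fun p : X × X => if p.1 = p.2 then (1 : ℂ) else 0) := by
    ext p q
    simp only [unnormMaxEnt, of_apply, vecMulVec_apply, Pi.star_apply]
    by_cases h1 : p.1 = p.2 <;> by_cases h2 : q.1 = q.2 <;> simp [h1, h2]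
  rw [this]
  exact posSemidef_vecMulVec_self_star _

/-- Complete positivity only speaks of references `Fin d`, so the reference copy of `X` is
relabelled by `Fin (card X)` and back. -/
theorem IsCompletelyPositive.posSemidef_choi [Fintype X] [DecidableEq X] {N : SuperOp X Y}
    (hN : IsCompletelyPositive N) : (choi N).PosSemidef := by
  set e := Fintype.equivFin X
  have h := hN (Fintype.card X) ((unnormMaxEnt X).submatrix (Prod.map e.symm id)
    (Prod.map e.symm id)) ((posSemidef_unnormMaxEnt X).submatrix _)
  rw [idTensor_submatrix] at h
  have h2 := h.submatrix (Prod.map e (id : Y → Y))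
  rw [submatrix_submatrix] at h2
  have : (Prod.map e.symm id ∘ Prod.map e (id : Y → Y)) = id := by
    ext p <;> simp
  rw [this, submatrix_id_id] at h2
  exact h2

/-- Choi's argument: factor the Choi operator as `Bᴴ B`; each row of `B`, conjugated and reshaped
into a matrix, is a Kraus operator. -/
theorem HasKraus.of_posSemidef_choi [Fintype X] [DecidableEq X] [Fintype Y]
    {N : SuperOp X Y} (hN : (choi N).PosSemidef) : HasKraus N := by
  classical
  obtain ⟨B, hB⟩ := PosSemidef.exists_conjTranspose_mul hN
  have : N = krausMap fun k : X × Y => of fun y x => star (B k (x, y)) := by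
    refine superOp_ext fun x x' => ?_
    ext y y'
    have := choi_apply N (x, y) (x', y')
    rw [hB] at this
    simp only at this
    rw [← this, krausMap_apply, Matrix.sum_apply, Matrix.mul_apply]
    refine Finset.sum_congr rfl fun k _ => ?_
    rw [Matrix.mul_assoc]
    simp [Matrix.mul_apply, single_apply, ite_and, conjTranspose_apply]
  rw [this]
  exact hasKraus_krausMap _

theorem IsCompletelyPositive.hasKraus [Fintype X] [DecidableEq X] [Fintype Y] {N : SuperOp X Y}
    (hN : IsCompletelyPositive N) : HasKraus N :=
  .of_posSemidef_choi hN.posSemidef_choi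

theorem HasKraus.posSemidef_choi [Fintype X] [DecidableEq X] [Fintype Y] {N : SuperOp X Y}
    (hN : HasKraus N) : (choi N).PosSemidef := by
  obtain ⟨r, A, rfl⟩ := hN
  have : choi (krausMap A) = ∑ k, vecMulVec (fun p : X × Y => A k p.2 p.1)
      (star fun p : X × Y => A k p.2 p.1) := by
    ext p q
    rw [choi_apply, krausMap_apply, Matrix.sum_apply, Matrix.sum_apply]
    refine Finset.sum_congr rfl fun k _ => ?_
    rw [Matrix.mul_assoc]
    simp [Matrix.mul_apply, single_apply, ite_and, conjTranspose_apply, vecMulVec_apply]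
  rw [this]
  exact posSemidef_sum _ fun k _ => posSemidef_vecMulVec_self_star _

theorem applyMiddle_apply (A B : Type*) (N : SuperOp X Y) (W : Op ((A × X) × B))
    (p q : A × (Y × B)) : applyMiddle A B N W p q =
      N (of fun x x' => W ((p.1, x), p.2.2) ((q.1, x'), q.2.2)) p.2.1 q.2.1 := rfl

theorem applyMiddle_single (A B : Type*) [DecidableEq A] [DecidableEq B] [DecidableEq X]
    (N : SuperOp X Y) (u v : (A × X) × B) (p q : A × (Y × B)) :
    applyMiddle A B N (single u v 1) p q =
      if (u.1.1 = p.1 ∧ u.2 = p.2.2) ∧ (v.1.1 = q.1 ∧ v.2 = q.2.2) then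
        N (single u.1.2 v.1.2 1) p.2.1 q.2.1 else 0 := by
  rw [applyMiddle_apply]
  obtain ⟨⟨ua, ux⟩, ub⟩ := u
  obtain ⟨⟨va, vx⟩, vb⟩ := v
  split_ifs with h
  · simp only at h
    have : (of fun x x' => single ((ua, ux), ub) ((va, vx), vb) (1 : ℂ) ((p.1, x), p.2.2)
        ((q.1, x'), q.2.2)) = single ux vx 1 := by
      ext x x'
      simp [single_apply, h.1.1, h.1.2, h.2.1, h.2.2]
    rw [this]
  · have : (of fun x x' => single ((ua, ux), ub) ((va, vx), vb) (1 : ℂ) ((p.1, x), p.2.2)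
        ((q.1, x'), q.2.2)) = 0 := by
      ext x x'
      simp only [of_apply, single_apply, Prod.mk.injEq, Matrix.zero_apply]
      simp only at h
      rw [if_neg]
      rintro ⟨⟨⟨h1, -⟩, h2⟩, ⟨h3, -⟩, h4⟩
      exact h ⟨⟨h1, h2⟩, h3, h4⟩
    rw [this, map_zero]
    rfl

theorem HasKraus.applyMiddle (A B : Type*) [Fintype A] [Fintype B] [Fintype X]
    {N : SuperOp X Y} (hN : HasKraus N) : HasKraus (applyMiddle A B N) := by
  classical
  obtain ⟨r, K, rfl⟩ := hN
  have : QInfo.applyMiddle A B (krausMap K) = krausMap fun k : Fin r =>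
      of fun (p : A × (Y × B)) (u : (A × X) × B) =>
        if u.1.1 = p.1 ∧ u.2 = p.2.2 then K k p.2.1 u.1.2 else 0 := by
    refine superOp_ext fun u v => ?_
    ext p q
    rw [applyMiddle_single, krausMap_apply, krausMap_apply, Matrix.sum_apply, Matrix.sum_apply]
    have hs (P : Prop) [Decidable P] (f : Fin r → ℂ) :
        (if P then ∑ k, f k else 0) = ∑ k, if P then f k else 0 := by split_ifs <;> simp
    rw [hs]
    refine Finset.sum_congr rfl fun k _ => ?_
    rw [Matrix.mul_assoc, Matrix.mul_assoc]
    obtain ⟨⟨ua, ux⟩, ub⟩ := u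
    obtain ⟨⟨va, vx⟩, vb⟩ := v
    by_cases h1 : ua = p.1 ∧ ub = p.2.2 <;> by_cases h2 : va = q.1 ∧ vb = q.2.2 <;>
      simp [h1, h2, Matrix.mul_apply, single_apply, ite_and, conjTranspose_apply] <;> tauto
  rw [this]
  exact hasKraus_krausMap _

end Maps

/-! ## The classical Rényi weight `p ^ α q ^ (1 - α)` -/

/-- The extended nonnegative real `p ^ α q ^ (1 - α)`, infinite if `q = 0 < p`. -/
noncomputable def renyiWeight (α p q : ℝ) : ENNReal :=
  ENNReal.ofReal p ^ α * ENNReal.ofReal q ^ (1 - α)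

section RenyiWeight

variable {α : ℝ}

theorem renyiWeight_mono (hα : 1 < α) {p p' q q' : ℝ} (hp : p ≤ p') (hq : q' ≤ q) :
    renyiWeight α p q ≤ renyiWeight α p' q' := by
  refine mul_le_mul' (ENNReal.rpow_le_rpow (ENNReal.ofReal_le_ofReal hp) (by linarith)) ?_
  rw [← neg_sub, ENNReal.rpow_neg, ENNReal.rpow_neg, ENNReal.inv_le_inv]
  exact ENNReal.rpow_le_rpow (ENNReal.ofReal_le_ofReal hq) (by linarith)

theorem renyiWeight_mul {c d : ℝ} (hc : 0 ≤ c) (hd : 0 ≤ d) (a b : ℝ) :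
    renyiWeight α (c * a) (d * b) = renyiWeight α c d * renyiWeight α a b := by
  unfold renyiWeight
  rw [ENNReal.ofReal_mul hc, ENNReal.ofReal_mul hd,
    ENNReal.mul_rpow_of_ne_top ENNReal.ofReal_ne_top ENNReal.ofReal_ne_top,
    ENNReal.mul_rpow_of_ne_top ENNReal.ofReal_ne_top ENNReal.ofReal_ne_top]
  ring

theorem renyiWeight_prod {ι : Type*} (s : Finset ι) {a b : ι → ℝ} (ha : ∀ i, 0 ≤ a i)
    (hb : ∀ i, 0 ≤ b i) :
    renyiWeight α (∏ i ∈ s, a i) (∏ i ∈ s, b i) = ∏ i ∈ s, renyiWeight α (a i) (b i) := by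
  classical
  induction s using Finset.induction_on with
  | empty => simp [renyiWeight]
  | insert i s hi ih =>
    rw [Finset.prod_insert hi, Finset.prod_insert hi, Finset.prod_insert hi,
      renyiWeight_mul (ha i) (hb i), ih]

theorem renyiWeight_self (hα : 1 < α) (p : ℝ) : renyiWeight α p p = ENNReal.ofReal p := by
  unfold renyiWeight
  rcases eq_or_ne (ENNReal.ofReal p) 0 with h | h
  · rw [h, ENNReal.zero_rpow_of_pos (by linarith), zero_mul]
  · rw [← ENNReal.rpow_add _ _ h ENNReal.ofReal_ne_top]
    simp

theorem renyiWeight_pos (hα : 1 < α) {p : ℝ} (hp : 0 < p) (q : ℝ) : 0 < renyiWeight α p q := by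
  refine ENNReal.mul_pos (ENNReal.rpow_pos (by simpa using hp) ENNReal.ofReal_ne_top).ne' ?_
  rw [← neg_sub, ENNReal.rpow_neg]
  exact ENNReal.inv_ne_zero.2 (ENNReal.rpow_ne_top_of_nonneg (by linarith) ENNReal.ofReal_ne_top)

theorem renyiWeight_eq_ofReal (hα : 1 < α) {p q : ℝ} (hp : 0 ≤ p) (hq : 0 < q) :
    renyiWeight α p q = ENNReal.ofReal (p ^ α * q ^ (1 - α)) := by
  unfold renyiWeight
  rw [ENNReal.ofReal_mul (by positivity), ENNReal.ofReal_rpow_of_nonneg hp (by linarith),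
    ENNReal.ofReal_rpow_of_pos hq]

/-- Joint subadditivity of the Rényi weight, a form of Hölder's inequality. -/
theorem renyiWeight_sum_le (hα : 1 < α) {ι : Type*} (s : Finset ι) {a b : ι → ℝ}
    (ha : ∀ i, 0 ≤ a i) (hb : ∀ i, 0 ≤ b i) :
    renyiWeight α (∑ i ∈ s, a i) (∑ i ∈ s, b i) ≤ ∑ i ∈ s, renyiWeight α (a i) (b i) := by
  have hα0 : 0 < α := by linarith
  by_cases hex : ∃ i ∈ s, b i = 0 ∧ a i ≠ 0
  · obtain ⟨i, hi, hbi, hai⟩ := hex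
    -- A term with `b i = 0 < a i` makes the right-hand side infinite. Afterwards `a i` vanishes
    -- wherever `b i` does, so the ratios `A i / B i` are harmless.
    have : renyiWeight α (a i) (b i) = ⊤ := by
      unfold renyiWeight
      rw [hbi, ENNReal.ofReal_zero, ENNReal.zero_rpow_of_neg (by linarith)]
      refine ENNReal.mul_top (ENNReal.rpow_pos ?_ ENNReal.ofReal_ne_top).ne'
      simpa using lt_of_le_of_ne (ha i) hai.symm
    exact le_top.trans (this ▸ Finset.single_le_sum (f := fun i => renyiWeight α (a i) (b i))
      (fun _ _ => zero_le) hi)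
  push Not at hex
  rcases (Finset.sum_nonneg fun i _ => hb i : 0 ≤ ∑ i ∈ s, b i).eq_or_lt with h0 | h0
  · have hz : ∀ i ∈ s, b i = 0 := (Finset.sum_eq_zero_iff_of_nonneg fun i _ => hb i).1 h0.symm
    rw [Finset.sum_eq_zero fun i hi => hex i hi (hz i hi)]
    simp [renyiWeight, ENNReal.zero_rpow_of_pos hα0]
  set A : ι → ENNReal := fun i => ENNReal.ofReal (a i)
  set B : ι → ENNReal := fun i => ENNReal.ofReal (b i)
  have hB : ∀ i, B i ≠ ⊤ := fun i => ENNReal.ofReal_ne_top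
  have hAB : ∀ i ∈ s, B i * (A i / B i) = A i := fun i hi => by
    rcases (hb i).eq_or_lt with h | h
    · simp [A, hex i hi h.symm]
    · exact ENNReal.mul_div_cancel (by simpa [B] using h) (hB i)
  have hAB2 : ∀ i ∈ s, B i * (A i / B i) ^ α = A i ^ α * B i ^ (1 - α) := fun i hi => by
    rcases (hb i).eq_or_lt with h | h
    · simp [A, hex i hi h.symm, ENNReal.zero_rpow_of_pos hα0]
    · have hB0 : B i ≠ 0 := by simpa [B] using h
      rw [ENNReal.div_rpow_of_nonneg _ _ hα0.le, sub_eq_add_neg, ENNReal.rpow_add _ _ hB0 (hB i),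
        ENNReal.rpow_one, ENNReal.rpow_neg, div_eq_mul_inv]
      ring
  -- Weighted Hölder with weights `B i` and values `A i / B i`; raising it to the power `α` gives
  -- the claim after division by `(∑ B i) ^ (α - 1)`.
  have key := ENNReal.inner_le_weight_mul_Lp_of_nonneg s hα.le B (fun i => A i / B i)
  rw [Finset.sum_congr rfl hAB, Finset.sum_congr rfl hAB2] at key
  have h1 := ENNReal.rpow_le_rpow key hα0.le
  rw [ENNReal.mul_rpow_of_nonneg _ _ hα0.le, ← ENNReal.rpow_mul, ← ENNReal.rpow_mul,
    inv_mul_cancel₀ hα0.ne', ENNReal.rpow_one, sub_mul, inv_mul_cancel₀ hα0.ne', one_mul] at h1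
  unfold renyiWeight
  rw [ENNReal.ofReal_sum_of_nonneg fun i _ => ha i, ENNReal.ofReal_sum_of_nonneg fun i _ => hb i]
  change (∑ i ∈ s, A i) ^ α * (∑ i ∈ s, B i) ^ (1 - α) ≤ ∑ i ∈ s, A i ^ α * B i ^ (1 - α)
  have hS0 : ∑ i ∈ s, B i ≠ 0 := by
    simp only [B]
    rw [← ENNReal.ofReal_sum_of_nonneg fun i _ => hb i]
    simpa using h0
  have hS : ∑ i ∈ s, B i ≠ ⊤ := ENNReal.sum_ne_top.2 fun i _ => hB i
  calc _ ≤ (∑ i ∈ s, B i) ^ (α - 1) * (∑ i ∈ s, A i ^ α * B i ^ (1 - α)) *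
        (∑ i ∈ s, B i) ^ (1 - α) := mul_le_mul_left h1 _
    _ = (∑ i ∈ s, A i ^ α * B i ^ (1 - α)) *
        ((∑ i ∈ s, B i) ^ (α - 1) * (∑ i ∈ s, B i) ^ (1 - α)) := by ring
    _ = _ := by
        rw [← ENNReal.rpow_add _ _ hS0 hS]
        simp

end RenyiWeight

/-! ## Pinching -/

section Pinching

variable {Z J : Type*} [Fintype Z] [DecidableEq Z] [Fintype J] [DecidableEq J]

/-- The pinching inequality: a positive semidefinite operator is at most `v` times its pinching
onto the `v` level sets of `d`. -/
theorem pinching_posSemidef {T : Op J} (hT : T.PosSemidef) (d : J → ℝ) {v : ℕ}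
    (hv : (Finset.univ.image d).card ≤ v) :
    ((v : ℂ) • (of fun i j => if d i = d j then T i j else 0) - T).PosSemidef := by
  set S := Finset.univ.image d
  set P : ℝ → Op J := fun c => diagonal fun j => if d j = c then 1 else 0
  have hPh (c : ℝ) : (P c)ᴴ = P c := by
    simp only [P, diagonal_conjTranspose]
    congr 1
    ext j
    simp [apply_ite]
  have hpin : (of fun i j => if d i = d j then T i j else 0) = ∑ c ∈ S, P c * T * P c := by
    ext i j
    rw [Matrix.sum_apply]
    simp only [P, of_apply, mul_diagonal, diagonal_mul]
    rw [Finset.sum_eq_single (d i)]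
    · by_cases h : d i = d j <;> simp [h, eq_comm]
    · intro c _ hc
      simp [hc.symm]
    · intro h
      exact (h (Finset.mem_image_of_mem d (Finset.mem_univ i))).elim
  have hsum : ∑ c ∈ S, P c = 1 := by
    ext i j
    rw [Matrix.sum_apply]
    by_cases h : i = j
    · subst h
      simp only [P, diagonal_apply_eq, one_apply_eq]
      rw [Finset.sum_ite_eq, if_pos (Finset.mem_image_of_mem d (Finset.mem_univ i))]
    · simp [P, h]
  have hpsd : (∑ c ∈ S, P c * T * P c).PosSemidef := posSemidef_sum _ fun c _ => by
    have := hT.mul_mul_conjTranspose_same (P c)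
    rwa [hPh] at this
  have hcard : ((S.card : ℂ) • (∑ c ∈ S, P c * T * P c) - T).PosSemidef := by
    -- The difference is half a sum of the positive terms `(P c - P c') T (P c - P c')ᴴ`: the square
    -- terms give the pinching `2 |S|` times, and the cross terms give `T` twice since the `P c` sum
    -- to one.
    have e : (S.card : ℂ) • (∑ c ∈ S, P c * T * P c) - T =
        (1 / 2 : ℂ) • ∑ c ∈ S, ∑ c' ∈ S, (P c - P c') * T * (P c - P c')ᴴ := by
      have h1 : ∑ c ∈ S, ∑ c' ∈ S, (P c - P c') * T * (P c - P c')ᴴ =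
          (2 : ℂ) • ((S.card : ℂ) • (∑ c ∈ S, P c * T * P c) - T) := by
        have h2 : ∑ c ∈ S, ∑ c' ∈ S, P c * T * P c' = T := by
          simp only [← Matrix.mul_sum, ← Matrix.sum_mul, hsum, Matrix.mul_one, Matrix.one_mul]
        have h3 : ∑ c ∈ S, ∑ c' ∈ S, P c' * T * P c = T := by
          rw [Finset.sum_comm]; exact h2
        simp only [conjTranspose_sub, hPh, Matrix.mul_sub, Matrix.sub_mul,
          Finset.sum_sub_distrib, h2, h3, Finset.sum_const, ← Finset.smul_sum]
        rw [two_smul, Nat.cast_smul_eq_nsmul]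
        abel
      rw [h1, smul_smul]
      norm_num
    rw [e]
    refine PosSemidef.smul (posSemidef_sum _ fun c _ => posSemidef_sum _ fun c' _ =>
      hT.mul_mul_conjTranspose_same _) ?_
    rw [Complex.le_def]
    norm_num
  rw [hpin]
  have e : (v : ℂ) • (∑ c ∈ S, P c * T * P c) - T =
      ((v - S.card : ℕ) : ℂ) • (∑ c ∈ S, P c * T * P c) +
        ((S.card : ℂ) • (∑ c ∈ S, P c * T * P c) - T) := by
    rw [Nat.cast_sub hv, sub_smul]
    abel
  rw [e]
  exact (hpsd.smul (Nat.cast_nonneg _)).add hcard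

/-- A positive semidefinite matrix can be diagonalized within the level sets of `d`. -/
theorem exists_unitary_diagonal_on_levels {T : Op J} (hT : T.IsHermitian) (d : J → ℝ) :
    ∃ W : Op J, W * Wᴴ = 1 ∧ Wᴴ * W = 1 ∧ (∀ i j, d i ≠ d j → W i j = 0) ∧
      ∀ i j, i ≠ j → d i = d j → (Wᴴ * T * W) i j = 0 := by
  classical
  let f : J → Set.range d := Set.rangeFactorization d
  let e : (Σ c : Set.range d, {j // f j = c}) ≃ J := Equiv.sigmaFiberEquiv f
  have hTc (c : Set.range d) :
      (T.submatrix (Subtype.val : {j // f j = c} → J) Subtype.val).IsHermitian := hT.submatrix _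
  -- Diagonalize each diagonal block of `T`, one per value of `d`, and assemble the eigenvector
  -- matrices block-diagonally.
  let V : Matrix (Σ c : Set.range d, {j // f j = c}) (Σ c : Set.range d, {j // f j = c}) ℂ :=
    blockDiagonal' fun c => ((hTc c).eigenvectorUnitary : Op {j // f j = c})
  have hV1 : V * Vᴴ = 1 := by
    rw [blockDiagonal'_conjTranspose, ← blockDiagonal'_mul, ← blockDiagonal'_one]
    congr 1
    ext1 c
    exact (diagonalizes_of_isHermitian (hTc c)).mul_conjTranspose_self
  have hV2 : Vᴴ * V = 1 := by
    rw [blockDiagonal'_conjTranspose, ← blockDiagonal'_mul, ← blockDiagonal'_one]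
    congr 1
    ext1 c
    exact (diagonalizes_of_isHermitian (hTc c)).conjTranspose_mul_self
  have hV0 (p q : Σ c : Set.range d, {j // f j = c}) (h : p.1 ≠ q.1) : V p q = 0 := by
    simp only [V]
    rw [blockDiagonal'_apply, dif_neg h]
  refine ⟨V.submatrix e.symm e.symm, ?_, ?_, ?_, ?_⟩
  · rw [conjTranspose_submatrix, submatrix_mul_equiv, hV1, submatrix_one_equiv]
  · rw [conjTranspose_submatrix, submatrix_mul_equiv, hV2, submatrix_one_equiv]
  · intro i j hij
    exact hV0 _ _ fun h => hij (congrArg Subtype.val h)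
  · intro i j hij hd
    have hT' : T = (T.submatrix e e).submatrix e.symm e.symm := by simp
    rw [hT', conjTranspose_submatrix, submatrix_mul_equiv, submatrix_mul_equiv, submatrix_apply]
    have hc : (e.symm i).1 = (e.symm j).1 := Subtype.ext hd
    obtain ⟨p, rfl⟩ := e.surjective i
    obtain ⟨q, rfl⟩ := e.surjective j
    simp only [Equiv.symm_apply_apply] at hc ⊢
    obtain ⟨c, p⟩ := p
    obtain ⟨c', q⟩ := q
    simp only at hc
    subst hc
    have hpq : p ≠ q := fun h => hij (by rw [h])
    have h1 := (diagonalizes_of_isHermitian (hTc c)).conj_eq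
    have h2 := congrFun (congrFun h1 p) q
    rw [diagonal_apply_ne _ hpq] at h2
    rw [← h2]
    simp only [Matrix.mul_apply, Fintype.sum_sigma]
    rw [Finset.sum_eq_single c]
    · refine Finset.sum_congr rfl fun k _ => ?_
      congr 1
      · rw [Finset.sum_eq_single c]
        · refine Finset.sum_congr rfl fun l _ => ?_
          congr 1
          simp only [V, conjTranspose_apply, blockDiagonal'_apply_eq]
        · intro c' _ hc'
          refine Finset.sum_eq_zero fun l _ => ?_
          rw [conjTranspose_apply, hV0 _ _ hc']
          simp
        · simp
      · simp only [V, blockDiagonal'_apply_eq]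
    · intro c' _ hc'
      refine Finset.sum_eq_zero fun l _ => ?_
      rw [hV0 _ _ hc']
      simp
    · simp

/-- If `σ` has at most `v` distinct eigenvalues, then it has an eigenbasis in which `ρ` is at most
`v` times its diagonal part. -/
theorem Diagonalizes.exists_pinching {ρ σ : Op Z} (hρ : ρ.PosSemidef) {U : Matrix Z J ℂ}
    {d : J → ℝ} (h : Diagonalizes U d σ) {v : ℕ} (hv : (Finset.univ.image d).card ≤ v) :
    ∃ U' : Matrix Z J ℂ, Diagonalizes U' d σ ∧
      ((v : ℂ) • (U' * diagonal (fun j => (U'ᴴ * ρ * U') j j) * U'ᴴ) - ρ).PosSemidef := by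
  have hρ' := hρ.conjTranspose_mul_mul_same U
  obtain ⟨W, hW1, hW2, hW3, hW4⟩ := exists_unitary_diagonal_on_levels hρ'.1 d
  -- `W` mixes only vectors with the same eigenvalue, so `U * W` is still an eigenbasis of `σ`.
  have hcomm : W * diagonal (fun j => (d j : ℂ)) = diagonal (fun j => (d j : ℂ)) * W := by
    ext i j
    rw [mul_diagonal, diagonal_mul]
    by_cases hij : d i = d j
    · rw [hij, mul_comm]
    · rw [hW3 i j hij]; simp
  have hU' : Diagonalizes (U * W) d σ := by
    refine ⟨?_, ?_, ?_⟩
    · rw [conjTranspose_mul, Matrix.mul_assoc, ← Matrix.mul_assoc W, hW1, Matrix.one_mul,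
        h.mul_conjTranspose_self]
    · rw [conjTranspose_mul, Matrix.mul_assoc, ← Matrix.mul_assoc Uᴴ, h.conjTranspose_mul_self,
        Matrix.one_mul, hW2]
    · rw [Matrix.mul_assoc U W, hcomm, conjTranspose_mul, ← Matrix.mul_assoc U,
        Matrix.mul_assoc _ W, ← Matrix.mul_assoc W, hW1, Matrix.one_mul, h.eq]
  refine ⟨U * W, hU', ?_⟩
  set U' := U * W
  have hT : (U'ᴴ * ρ * U').PosSemidef := hρ.conjTranspose_mul_mul_same U'
  have hTW : U'ᴴ * ρ * U' = Wᴴ * (Uᴴ * ρ * U) * W := by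
    simp only [U', conjTranspose_mul, Matrix.mul_assoc]
  have hpin := pinching_posSemidef hT d hv
  -- In the new basis the pinching is fully diagonal: entries between different levels are cut off,
  -- and off-diagonal entries within a level vanish by the choice of `W`.
  have e : (of fun i j => if d i = d j then (U'ᴴ * ρ * U') i j else 0) =
      diagonal fun j => (U'ᴴ * ρ * U') j j := by
    ext i j
    rw [of_apply]
    by_cases hij : i = j
    · subst hij; simp
    · rw [diagonal_apply_ne _ hij]
      split_ifs with hd
      · rw [hTW]; exact hW4 i j hij hd
      · rfl
  rw [e] at hpin
  have := hpin.mul_mul_conjTranspose_same U'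
  rw [Matrix.mul_sub, Matrix.sub_mul] at this
  convert this using 2
  · simp
  · calc ρ = (U' * U'ᴴ) * ρ * (U' * U'ᴴ) := by rw [hU'.mul_conjTranspose_self]; simp
      _ = _ := by simp only [Matrix.mul_assoc]

/-- The rank-one operator of the `j`-th column of `U`. -/
def colProj (U : Matrix Z J ℂ) (j : J) : Op Z := vecMulVec (fun z => U z j) (star fun z => U z j)

omit [Fintype Z] [DecidableEq Z] in
theorem mul_diagonal_mul_conjTranspose (U : Matrix Z J ℂ) (d : J → ℂ) :
    U * diagonal d * Uᴴ = ∑ j, d j • colProj U j := by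
  ext z z'
  rw [Matrix.sum_apply, Matrix.mul_apply]
  refine Finset.sum_congr rfl fun j _ => ?_
  rw [mul_diagonal, conjTranspose_apply, Matrix.smul_apply, colProj, vecMulVec_apply, smul_eq_mul]
  simp only [Pi.star_apply]
  ring

omit [DecidableEq Z] [Fintype J] [DecidableEq J] in
theorem colProj_posSemidef (U : Matrix Z J ℂ) (j : J) : (colProj U j).PosSemidef :=
  posSemidef_vecMulVec_self_star _

/-- A pinched form of data processing: the Rényi weights of positive functionals of `ρ` and `σ` are
controlled by the diagonal weights in an eigenbasis of `σ`. -/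
theorem Diagonalizes.exists_sum_renyiWeight_le {α : ℝ} (hα : 1 < α) {ρ σ : Op Z}
    (hρ : ρ.PosSemidef) (hσ : σ.PosSemidef) {U : Matrix Z J ℂ} {d : J → ℝ}
    (h : Diagonalizes U d σ) {v : ℕ} (hv : (Finset.univ.image d).card ≤ v) :
    ∃ U' : Matrix Z J ℂ, Diagonalizes U' d σ ∧ ∀ {κ : Type} [Fintype κ]
      (f g : κ → Op Z →ₗ[ℝ] ℝ) (_ : ∀ x W, W.PosSemidef → 0 ≤ f x W)
      (_ : ∀ x W, W.PosSemidef → 0 ≤ g x W),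
      ∑ x, renyiWeight α (f x ρ) (g x σ) ≤ (v : ENNReal) ^ α *
        ∑ j, renyiWeight α ((U'ᴴ * ρ * U') j j).re (d j) *
          ∑ x, renyiWeight α (f x (colProj U' j)) (g x (colProj U' j)) := by
  obtain ⟨U', hU', hpin⟩ := h.exists_pinching hρ hv
  -- The basis is fixed before the functionals, so the same `U'` serves every measurement.
  refine ⟨U', hU', fun {κ} _ f g hf hg => ?_⟩
  set r : J → ℝ := fun j => ((U'ᴴ * ρ * U') j j).re
  have hT := hρ.conjTranspose_mul_mul_same U'
  have hr0 (j : J) : 0 ≤ r j := (Complex.le_def.1 (hT.diag_nonneg (i := j))).1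
  have hr (j : J) : (U'ᴴ * ρ * U') j j = (r j : ℂ) :=
    Complex.ext rfl (Complex.le_def.1 (hT.diag_nonneg (i := j))).2.symm
  have hd0 := hU'.nonneg hσ
  -- An upper bound on `f x ρ` suffices because the Rényi weight increases in its first argument. It
  -- decreases in the second, which is why `σ` is expanded exactly, with no pinching loss.
  have hfρ (x : κ) : f x ρ ≤ ∑ j, v * r j * f x (colProj U' j) := by
    have := hf x _ hpin
    rw [mul_diagonal_mul_conjTranspose, map_sub, sub_nonneg] at this
    refine this.trans_eq ?_
    rw [Finset.smul_sum, map_sum]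
    refine Finset.sum_congr rfl fun j _ => ?_
    have e : (v : ℂ) • (U'ᴴ * ρ * U') j j • colProj U' j = (v * r j : ℝ) • colProj U' j := by
      rw [hr, smul_smul]
      ext a b
      simp
    rw [e, map_smul, smul_eq_mul]
  have hgσ (x : κ) : g x σ = ∑ j, d j * g x (colProj U' j) := by
    conv_lhs => rw [hU'.eq, mul_diagonal_mul_conjTranspose]
    rw [map_sum]
    refine Finset.sum_congr rfl fun j _ => ?_
    have e : (d j : ℂ) • colProj U' j = d j • colProj U' j := by
      ext a b
      simp
    rw [e, map_smul, smul_eq_mul]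
  have hf0 (x : κ) (j : J) := hf x _ (colProj_posSemidef U' j)
  have hg0 (x : κ) (j : J) := hg x _ (colProj_posSemidef U' j)
  calc ∑ x, renyiWeight α (f x ρ) (g x σ)
      ≤ ∑ x, ∑ j, renyiWeight α (v * r j * f x (colProj U' j)) (d j * g x (colProj U' j)) := by
        refine Finset.sum_le_sum fun x _ => ?_
        refine (renyiWeight_mono hα (hfρ x) (hgσ x).ge).trans (renyiWeight_sum_le hα _ ?_ ?_)
        · exact fun j => mul_nonneg (mul_nonneg v.cast_nonneg (hr0 j)) (hf0 x j)
        · exact fun j => mul_nonneg (hd0 j) (hg0 x j)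
    _ = ∑ x, ∑ j, (v : ENNReal) ^ α * (renyiWeight α (r j) (d j) *
          renyiWeight α (f x (colProj U' j)) (g x (colProj U' j))) := by
        refine Finset.sum_congr rfl fun x _ => Finset.sum_congr rfl fun j _ => ?_
        rw [← renyiWeight_mul (hr0 j) (hd0 j)]
        have := renyiWeight_mul (α := α) v.cast_nonneg zero_le_one (r j * f x (colProj U' j))
          (d j * g x (colProj U' j))
        rw [one_mul, ← mul_assoc] at this
        rw [this]
        simp [renyiWeight]
    _ = _ := by
        rw [Finset.sum_comm, Finset.mul_sum]
        refine Finset.sum_congr rfl fun j _ => ?_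
        rw [Finset.mul_sum, Finset.mul_sum]

end Pinching

/-! ## Measurements and the sandwiched trace functional -/

section Measure

variable {Z J : Type*} [Fintype Z] [DecidableEq Z] [Fintype J] [DecidableEq J]

omit [DecidableEq Z] in
theorem trace_mul_nonneg {E W : Op Z} (hE : E.PosSemidef) (hW : W.PosSemidef) :
    0 ≤ (E * W).trace := by
  obtain ⟨B, rfl⟩ := PosSemidef.exists_conjTranspose_mul hE
  rw [Matrix.mul_assoc, trace_mul_comm]
  exact (hW.mul_mul_conjTranspose_same B).trace_nonneg

omit [DecidableEq Z] in
theorem trace_mul_re_nonneg {E W : Op Z} (hE : E.PosSemidef) (hW : W.PosSemidef) :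
    0 ≤ (E * W).trace.re := (Complex.le_def.1 (trace_mul_nonneg hE hW)).1

omit [DecidableEq Z] in
theorem trace_mul_eq_re {E W : Op Z} (hE : E.PosSemidef) (hW : W.PosSemidef) :
    (E * W).trace = ((E * W).trace.re : ℂ) :=
  Complex.ext rfl (Complex.le_def.1 (trace_mul_nonneg hE hW)).2.symm

omit [DecidableEq Z] in
theorem trace_eq_re {W : Op Z} (hW : W.PosSemidef) : W.trace = (W.trace.re : ℂ) :=
  Complex.ext rfl (Complex.le_def.1 hW.trace_nonneg).2.symm

omit [DecidableEq Z] in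
theorem trace_re_nonneg {W : Op Z} (hW : W.PosSemidef) : 0 ≤ W.trace.re :=
  (Complex.le_def.1 hW.trace_nonneg).1

/-- The functional `W ↦ Re tr (E W)`. -/
noncomputable def effectFun (E : Op Z) : Op Z →ₗ[ℝ] ℝ where
  toFun W := (E * W).trace.re
  map_add' V W := by simp [Matrix.mul_add]
  map_smul' c W := by simp

/-- A family of effects whose sum is at most the identity. -/
structure IsSubPOVM {κ : Type*} [Fintype κ] (E : κ → Op Z) : Prop where
  posSemidef : ∀ x, (E x).PosSemidef
  sum_le_one : (1 - ∑ x, E x).PosSemidef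

/-- The classical Rényi sum of the outcome weights of `ρ` and `σ` under `E`. -/
noncomputable def measuredSum {κ : Type*} [Fintype κ] (α : ℝ) (E : κ → Op Z) (ρ σ : Op Z) :
    ENNReal :=
  ∑ x, renyiWeight α (E x * ρ).trace.re (E x * σ).trace.re

/-- The trace functional inside the sandwiched Rényi divergence. -/
noncomputable def sandwichedQ (α : ℝ) (ρ σ : Op Z) : ℝ :=
  (opPow (opPow σ ((1 - α) / (2 * α)) * ρ * opPow σ ((1 - α) / (2 * α))) α).trace.re

theorem IsSubPOVM.sum_le_trace {κ : Type*} [Fintype κ] {E : κ → Op Z} (hE : IsSubPOVM E)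
    {W : Op Z} (hW : W.PosSemidef) : ∑ x, (E x * W).trace.re ≤ W.trace.re := by
  have := trace_mul_re_nonneg hE.sum_le_one hW
  rw [Matrix.sub_mul, Matrix.one_mul, Matrix.sum_mul, trace_sub, trace_sum, Complex.sub_re,
    Complex.re_sum] at this
  linarith

theorem measuredSum_self_le {κ : Type*} [Fintype κ] {α : ℝ} (hα : 1 < α) {E : κ → Op Z}
    (hE : IsSubPOVM E) {W : Op Z} (hW : W.PosSemidef) :
    measuredSum α E W W ≤ ENNReal.ofReal W.trace.re := by
  unfold measuredSum
  simp only [renyiWeight_self hα]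
  rw [← ENNReal.ofReal_sum_of_nonneg fun x _ => trace_mul_re_nonneg (hE.posSemidef x) hW]
  exact ENNReal.ofReal_le_ofReal (hE.sum_le_trace hW)

theorem sandwiched_posSemidef {ρ σ : Op Z} (hρ : ρ.PosSemidef) (hσ : σ.PosSemidef) (s : ℝ) :
    (opPow σ s * ρ * opPow σ s).PosSemidef := by
  have := hρ.mul_mul_conjTranspose_same (opPow σ s)
  rwa [(opPow_isHermitian hσ.1 s).eq] at this

/-- The witness is `K = ρ σ⁻¹` with the generalized inverse, since the columns of `1 - σ⁻¹ σ` lie in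
the kernel of `σ`. The factorized form passes directly to tensor products. -/
theorem suppLE_iff {ρ σ : Op Z} (hσ : σ.PosSemidef) : SuppLE ρ σ ↔ ∃ K : Op Z, ρ = K * σ := by
  constructor
  · intro h
    have h1 := mul_opPow_mul_opPow_neg hσ (-1)
    rw [neg_neg, opPow_one hσ.1] at h1
    refine ⟨ρ * opPow σ (-1), ?_⟩
    have h2 : ρ * (1 - opPow σ (-1) * σ) = 0 := by
      ext i j
      have h3 : σ.mulVec (fun k => (1 - opPow σ (-1) * σ) k j) = 0 := by
        have : σ * (1 - opPow σ (-1) * σ) = 0 := by rw [Matrix.mul_sub, h1]; simp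
        ext i
        exact congrFun (congrFun this i) j
      exact congrFun (h _ h3) i
    rw [Matrix.mul_sub, Matrix.mul_one, sub_eq_zero] at h2
    rw [Matrix.mul_assoc]
    exact h2
  · rintro ⟨K, rfl⟩ v hv
    rw [← mulVec_mulVec, hv, mulVec_zero]

/-- The Peierls inequality for powers. -/
theorem sum_diag_rpow_le {α : ℝ} (hα : 1 < α) {C : Op Z} (hC : C.PosSemidef) {U : Matrix Z J ℂ}
    (hU1 : U * Uᴴ = 1) (hU2 : Uᴴ * U = 1) :
    ∑ j, ((Uᴴ * C * U) j j).re ^ α ≤ (opPow C α).trace.re := by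
  have h := diagonalizes_of_isHermitian hC.1
  set V : Matrix Z Z ℂ := (hC.1.eigenvectorUnitary : Matrix Z Z ℂ)
  set c := hC.1.eigenvalues
  set T := Uᴴ * V
  have hT1 : T * Tᴴ = 1 := by
    simp only [T, conjTranspose_mul, conjTranspose_conjTranspose]
    rw [Matrix.mul_assoc, ← Matrix.mul_assoc V, h.mul_conjTranspose_self, Matrix.one_mul, hU2]
  have hT2 : Tᴴ * T = 1 := by
    simp only [T, conjTranspose_mul, conjTranspose_conjTranspose]
    rw [Matrix.mul_assoc, ← Matrix.mul_assoc U, hU1, Matrix.one_mul, h.conjTranspose_mul_self]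
  -- The squared moduli of the unitary `T` are doubly stochastic: row sums allow Jensen's inequality
  -- for `t ^ α`, column sums then collapse the double sum to the trace.
  have hw1 (j : J) : ∑ l, Complex.normSq (T j l) = 1 := by
    have := congrFun (congrFun hT1 j) j
    rw [Matrix.mul_apply, one_apply_eq] at this
    simp only [conjTranspose_apply, RCLike.star_def, Complex.mul_conj] at this
    exact_mod_cast this
  have hw2 (l : Z) : ∑ j, Complex.normSq (T j l) = 1 := by
    have := congrFun (congrFun hT2 l) l
    rw [Matrix.mul_apply, one_apply_eq] at this
    simp only [conjTranspose_apply, RCLike.star_def, ← Complex.normSq_eq_conj_mul_self] at this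
    exact_mod_cast this
  have hdiag (j : J) : ((Uᴴ * C * U) j j).re = ∑ l, Complex.normSq (T j l) * c l := by
    have e : Uᴴ * C * U = T * diagonal (fun l => (c l : ℂ)) * Tᴴ := by
      conv_lhs => rw [h.eq]
      simp only [T, conjTranspose_mul, conjTranspose_conjTranspose, Matrix.mul_assoc]
    rw [e, Matrix.mul_apply, Complex.re_sum]
    refine Finset.sum_congr rfl fun l _ => ?_
    rw [mul_diagonal, conjTranspose_apply, mul_right_comm, RCLike.star_def, Complex.mul_conj,
      ← Complex.ofReal_mul, Complex.ofReal_re]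
  have htr : (opPow C α).trace.re = ∑ l, c l ^ α := by
    rw [(h.opPow α).trace, ← Complex.ofReal_sum, Complex.ofReal_re]
  rw [htr]
  calc ∑ j, ((Uᴴ * C * U) j j).re ^ α
      ≤ ∑ j, ∑ l, Complex.normSq (T j l) * c l ^ α := by
        refine Finset.sum_le_sum fun j _ => ?_
        rw [hdiag]
        exact Real.rpow_arith_mean_le_arith_mean_rpow _ _ _ (fun l _ => Complex.normSq_nonneg _)
          (hw1 j) (fun l _ => hC.eigenvalues_nonneg l) hα.le
    _ = ∑ l, c l ^ α := by
        rw [Finset.sum_comm]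
        refine Finset.sum_congr rfl fun l _ => ?_
        rw [← Finset.sum_mul, hw2, one_mul]

/-- In an eigenbasis of `σ` with `r j` the diagonal of `ρ`, the diagonal of `σ^s ρ σ^s` is `d j ^ (2
s) r j`. As `2 s α = 1 - α`, its `α`-th power is the Rényi weight, and Peierls' inequality bounds
the sum by the trace. -/
theorem Diagonalizes.sum_renyiWeight_le {α : ℝ} (hα : 1 < α) {ρ σ : Op Z}
    (hρ : ρ.PosSemidef) (hσ : σ.PosSemidef) (hs : SuppLE ρ σ) {U : Matrix Z J ℂ} {d : J → ℝ}
    (h : Diagonalizes U d σ) :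
    ∑ j, renyiWeight α ((Uᴴ * ρ * U) j j).re (d j) ≤ ENNReal.ofReal (sandwichedQ α ρ σ) := by
  set s := (1 - α) / (2 * α) with hs_def
  have hα0 : (0 : ℝ) < α := by linarith
  have hs0 : s ≠ 0 := div_ne_zero (by linarith) (by linarith)
  have hd := h.nonneg hσ
  have hr0 (j : J) : 0 ≤ ((Uᴴ * ρ * U) j j).re :=
    (Complex.le_def.1 ((hρ.conjTranspose_mul_mul_same U).diag_nonneg (i := j))).1
  have hC := sandwiched_posSemidef hρ hσ s
  have hdiag (j : J) : ((Uᴴ * (QInfo.opPow σ s * ρ * QInfo.opPow σ s) * U) j j).re =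
      d j ^ s * ((Uᴴ * ρ * U) j j).re * d j ^ s := by
    have e : Uᴴ * (QInfo.opPow σ s * ρ * QInfo.opPow σ s) * U =
        diagonal (fun j => ((d j ^ s : ℝ) : ℂ)) * (Uᴴ * ρ * U) *
          diagonal (fun j => ((d j ^ s : ℝ) : ℂ)) := by
      rw [← (h.opPow s).conj_eq]
      calc _ = Uᴴ * (QInfo.opPow σ s * 1 * ρ * 1 * QInfo.opPow σ s) * U := by simp
        _ = _ := by
          rw [← h.mul_conjTranspose_self]
          simp only [Matrix.mul_assoc]
    rw [e, mul_diagonal, diagonal_mul, Complex.re_mul_ofReal, Complex.re_ofReal_mul]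
  have hterm (j : J) : renyiWeight α ((Uᴴ * ρ * U) j j).re (d j) = ENNReal.ofReal
      (((Uᴴ * (QInfo.opPow σ s * ρ * QInfo.opPow σ s) * U) j j).re ^ α) := by
    rw [hdiag]
    rcases (hd j).eq_or_lt with h0 | h0
    -- At a zero eigenvalue the support condition forces the diagonal entry of `ρ` to vanish, so the
    -- weight is `0` rather than `⊤`.
    · have hcol : σ.mulVec (fun z => U z j) = 0 := by
        have : σ * U = U * diagonal (fun j => (d j : ℂ)) := by
          conv_lhs => rw [h.eq]
          rw [Matrix.mul_assoc, h.conjTranspose_mul_self, Matrix.mul_one]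
        ext i
        have h2 := congrFun (congrFun this i) j
        rw [mul_diagonal, ← h0] at h2
        rw [Complex.ofReal_zero, mul_zero] at h2
        exact h2
      have hρcol := hs _ hcol
      have : (Uᴴ * ρ * U) j j = 0 := by
        rw [Matrix.mul_assoc, Matrix.mul_apply]
        refine Finset.sum_eq_zero fun i _ => ?_
        have : (ρ * U) i j = 0 := congrFun hρcol i
        rw [this, mul_zero]
      rw [this, ← h0, Real.zero_rpow hs0]
      simp [renyiWeight, ENNReal.zero_rpow_of_pos hα0, Real.zero_rpow hα0.ne']
    · rw [renyiWeight_eq_ofReal hα (hr0 j) h0, Real.mul_rpow (by have := hr0 j; positivity)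
        (by positivity), Real.mul_rpow (by positivity) (hr0 j), ← Real.rpow_mul h0.le]
      have : s * α = (1 - α) / 2 := by rw [hs_def]; field_simp
      rw [this, mul_comm (d j ^ _), mul_assoc, ← Real.rpow_add h0]
      ring_nf
  simp only [hterm]
  rw [← ENNReal.ofReal_sum_of_nonneg fun j _ => Real.rpow_nonneg (by
    rw [hdiag]; exact mul_nonneg (mul_nonneg (Real.rpow_nonneg (hd j) _) (hr0 j))
      (Real.rpow_nonneg (hd j) _)) _]
  exact ENNReal.ofReal_le_ofReal
    (sum_diag_rpow_le hα hC h.mul_conjTranspose_self h.conjTranspose_mul_self)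

omit [DecidableEq Z] [Fintype J] in
theorem trace_colProj {U : Matrix Z J ℂ} (hU : Uᴴ * U = 1) (j : J) :
    (colProj U j).trace = 1 := by
  have := congrFun (congrFun hU j) j
  rw [one_apply_eq, Matrix.mul_apply] at this
  rw [← this, colProj, trace]
  refine Finset.sum_congr rfl fun z _ => ?_
  rw [diag_apply, vecMulVec_apply, conjTranspose_apply, mul_comm]
  rfl

/-- After pinching, each inner sum compares the outcome weights of a unit projector with themselves;
it is their total, hence at most one. The factor `v ^ α` is removed later by passing to tensor
powers. -/
theorem measuredSum_le_card_mul {κ : Type} [Fintype κ] {α : ℝ} (hα : 1 < α) {ρ σ : Op Z}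
    (hρ : ρ.PosSemidef) (hσ : σ.PosSemidef) (hs : SuppLE ρ σ) {U : Matrix Z J ℂ} {d : J → ℝ}
    (h : Diagonalizes U d σ) {v : ℕ} (hv : (Finset.univ.image d).card ≤ v) {E : κ → Op Z}
    (hE : IsSubPOVM E) :
    measuredSum α E ρ σ ≤ (v : ENNReal) ^ α * ENNReal.ofReal (sandwichedQ α ρ σ) := by
  obtain ⟨U', hU', key⟩ := h.exists_sum_renyiWeight_le hα hρ hσ hv
  have hf : ∀ x W, W.PosSemidef → 0 ≤ effectFun (E x) W :=
    fun x W hW => trace_mul_re_nonneg (hE.posSemidef x) hW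
  refine (key (fun x => effectFun (E x)) (fun x => effectFun (E x)) hf hf).trans ?_
  refine mul_le_mul_right ((Finset.sum_le_sum fun j _ => ?_).trans
    (hU'.sum_renyiWeight_le hα hρ hσ hs)) _
  refine mul_le_of_le_one_right' ?_
  refine (measuredSum_self_le hα hE (colProj_posSemidef U' j)).trans ?_
  rw [trace_colProj hU'.conjTranspose_mul_self]
  simp

end Measure

/-! ## Tensor powers -/

section Power

variable {Z J : Type*} [Fintype Z] [DecidableEq Z] [Fintype J] [DecidableEq J]

/-- The tensor power `W^{⊗ m}` of an operator. -/
abbrev opTensorPow (W : Op Z) (m : ℕ) : Op (Fin m → Z) := piTensor fun _ : Fin m => W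

omit [DecidableEq J] in
-- Method of types: the product depends only on how often each index occurs, and each such count
-- lies in `Fin (m + 1)`.
theorem card_image_prod_le (d : J → ℝ) (m : ℕ) :
    (Finset.univ.image fun y : Fin m → J => ∏ i, d (y i)).card ≤ (m + 1) ^ Fintype.card J := by
  classical
  let cnt : (Fin m → J) → (J → Fin (m + 1)) := fun y j =>
    ⟨(Finset.univ.filter fun i => y i = j).card, Nat.lt_succ_of_le
      ((Finset.card_filter_le _ _).trans (by simp))⟩
  have h : (fun y : Fin m → J => ∏ i, d (y i)) =
      (fun c : J → Fin (m + 1) => ∏ j, d j ^ (c j : ℕ)) ∘ cnt := by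
    ext y
    simp only [Function.comp_apply, cnt]
    rw [← Finset.prod_fiberwise' Finset.univ y d]
    simp
  rw [h, ← Finset.image_image]
  refine Finset.card_image_le.trans ((Finset.card_le_univ _).trans ?_)
  simp

theorem suppLE_opTensorPow {ρ σ : Op Z} (hσ : σ.PosSemidef) (hs : SuppLE ρ σ) (m : ℕ) :
    SuppLE (opTensorPow ρ m) (opTensorPow σ m) := by
  obtain ⟨K, hK⟩ := (suppLE_iff hσ).1 hs
  refine (suppLE_iff (piTensor_posSemidef fun _ => hσ)).2 ⟨opTensorPow K m, ?_⟩
  rw [piTensor_mul, ← hK]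

theorem sandwichedQ_opTensorPow {α : ℝ} {ρ σ : Op Z} (hρ : ρ.PosSemidef) (hσ : σ.PosSemidef)
    (m : ℕ) : sandwichedQ α (opTensorPow ρ m) (opTensorPow σ m) = sandwichedQ α ρ σ ^ m := by
  unfold sandwichedQ
  have hC := sandwiched_posSemidef hρ hσ ((1 - α) / (2 * α))
  rw [opPow_piTensor hσ, piTensor_mul, piTensor_mul, opPow_piTensor hC, trace_piTensor,
    Finset.prod_const, Finset.card_univ, Fintype.card_fin, trace_eq_re (opPow_posSemidef hC α),
    ← Complex.ofReal_pow, Complex.ofReal_re, Complex.ofReal_re]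

theorem Diagonalizes.one_sub {U : Matrix Z J ℂ} {d : J → ℝ} {W : Op Z}
    (h : Diagonalizes U d W) : Diagonalizes U (fun j => 1 - d j) (1 - W) where
  mul_conjTranspose_self := h.mul_conjTranspose_self
  conjTranspose_mul_self := h.conjTranspose_mul_self
  eq := by
    have : diagonal (fun j => ((1 - d j : ℝ) : ℂ)) = 1 - diagonal (fun j => (d j : ℂ)) := by
      rw [← diagonal_one, diagonal_sub]
      congr 1
      ext j
      push_cast
      rfl
    rw [this, Matrix.mul_sub, Matrix.sub_mul, ← h.eq, Matrix.mul_one, h.mul_conjTranspose_self]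

theorem one_sub_opTensorPow_posSemidef {W : Op Z} (hW : W.PosSemidef)
    (hW1 : (1 - W).PosSemidef) (m : ℕ) : (1 - opTensorPow W m).PosSemidef := by
  have h := diagonalizes_of_isHermitian hW.1
  refine (h.piTensor (ι := Fin m)).one_sub.posSemidef fun y => ?_
  rw [sub_nonneg]
  exact Finset.prod_le_one (fun i _ => hW.eigenvalues_nonneg _)
    fun i _ => sub_nonneg.1 (h.one_sub.nonneg hW1 _)

theorem IsSubPOVM.piTensor {κ : Type*} [Fintype κ] {E : κ → Op Z} (hE : IsSubPOVM E) (m : ℕ) :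
    IsSubPOVM fun x : Fin m → κ => piTensor fun i => E (x i) where
  posSemidef x := piTensor_posSemidef fun i => hE.posSemidef _
  sum_le_one := by
    have : ∑ x : Fin m → κ, QInfo.piTensor (fun i => E (x i)) = opTensorPow (∑ x, E x) m := by
      ext y y'
      simp only [Matrix.sum_apply, QInfo.piTensor, of_apply]
      rw [Finset.prod_univ_sum, Fintype.piFinset_univ]
    rw [this]
    exact one_sub_opTensorPow_posSemidef (posSemidef_sum _ fun x _ => hE.posSemidef x)
      hE.sum_le_one m

omit [DecidableEq Z] in
theorem trace_piTensor_mul_re {m : ℕ} {E W : Fin m → Op Z} (hE : ∀ i, (E i).PosSemidef)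
    (hW : ∀ i, (W i).PosSemidef) :
    (piTensor E * piTensor W).trace.re = ∏ i, (E i * W i).trace.re := by
  rw [piTensor_mul, trace_piTensor, Finset.prod_congr rfl fun i _ => trace_mul_eq_re (hE i) (hW i),
    ← Complex.ofReal_prod, Complex.ofReal_re]

theorem measuredSum_piTensor {κ : Type*} [Fintype κ] {α : ℝ} {E : κ → Op Z} (hE : IsSubPOVM E)
    {ρ σ : Op Z} (hρ : ρ.PosSemidef) (hσ : σ.PosSemidef) (m : ℕ) :
    measuredSum α (fun x : Fin m → κ => piTensor fun i => E (x i)) (opTensorPow ρ m)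
      (opTensorPow σ m) = measuredSum α E ρ σ ^ m := by
  unfold measuredSum
  have (x : Fin m → κ) : renyiWeight α ((piTensor fun i => E (x i)) * opTensorPow ρ m).trace.re
      ((piTensor fun i => E (x i)) * opTensorPow σ m).trace.re =
        ∏ i, renyiWeight α (E (x i) * ρ).trace.re (E (x i) * σ).trace.re := by
    rw [trace_piTensor_mul_re (fun i => hE.posSemidef _) fun _ => hρ,
      trace_piTensor_mul_re (fun i => hE.posSemidef _) fun _ => hσ]
    exact renyiWeight_prod _ (fun i => trace_mul_re_nonneg (hE.posSemidef _) hρ)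
      fun i => trace_mul_re_nonneg (hE.posSemidef _) hσ
  simp only [this]
  have h := Finset.prod_univ_sum (fun _ : Fin m => (Finset.univ : Finset κ))
    fun _ x => renyiWeight α (E x * ρ).trace.re (E x * σ).trace.re
  rw [Fintype.piFinset_univ, Finset.prod_const, Finset.card_univ, Fintype.card_fin] at h
  exact h.symm

/-- If `x > q > 0`, then `(x / q) ^ m` outgrows every polynomial. The cases `x = ⊤` and `q = 0` are
already excluded by `m = 1`. -/
theorem le_of_pow_le_polynomial_mul_pow {x : ENNReal} {q : ℝ} (hq : 0 ≤ q) (K : ℕ)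
    (h : ∀ m : ℕ, x ^ m ≤ ((m + 1 : ℕ) : ENNReal) ^ K * ENNReal.ofReal q ^ m) :
    x ≤ ENNReal.ofReal q := by
  have hx : x ≠ ⊤ := by
    intro hx
    have := h 1
    rw [hx, pow_one, pow_one, top_le_iff] at this
    exact ENNReal.mul_ne_top (ENNReal.pow_ne_top (ENNReal.natCast_ne_top _)) ENNReal.ofReal_ne_top
      this
  lift x to NNReal using hx
  rw [← ENNReal.ofReal_coe_nnreal]
  refine ENNReal.ofReal_le_ofReal ?_
  have hr (m : ℕ) : (x : ℝ) ^ m ≤ ((m : ℝ) + 1) ^ K * q ^ m := by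
    have := h m
    rw [← ENNReal.ofReal_coe_nnreal, ← ENNReal.ofReal_natCast, ← ENNReal.ofReal_pow (by positivity),
      ← ENNReal.ofReal_pow (by positivity), ← ENNReal.ofReal_pow (by positivity),
      ← ENNReal.ofReal_mul (by positivity), ENNReal.ofReal_le_ofReal_iff (by positivity)] at this
    simpa using this
  by_contra hlt
  push Not at hlt
  rcases hq.eq_or_lt with h0 | h0
  · have h1 := hr 1
    rw [← h0, pow_one, pow_one, mul_zero] at h1
    rw [← h0] at hlt
    exact absurd h1 (not_le.2 hlt)
  have h1 : 1 < (x : ℝ) / q := (one_lt_div h0).2 hlt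
  have hlim := (tendsto_pow_const_div_const_pow_of_one_lt K h1).comp
    (Filter.tendsto_add_atTop_nat 1)
  -- The limit is taken along `m + 1`; the threshold `(x / q)⁻¹` absorbs the extra factor and
  -- returns to exponent `m`.
  have hev := hlim.eventually (gt_mem_nhds (show (0 : ℝ) < ((x : ℝ) / q)⁻¹ by positivity))
  obtain ⟨m, hm⟩ := hev.exists
  simp only [Function.comp_apply, Nat.cast_add, Nat.cast_one] at hm
  rw [div_lt_iff₀ (by positivity), pow_succ', ← mul_assoc, inv_mul_cancel₀ (by positivity),
    one_mul, div_pow, lt_div_iff₀ (by positivity)] at hm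
  exact absurd (hr m) (not_le.2 hm)

/-- Rounding `α` up turns the pinching loss into a polynomial with a natural exponent. -/
theorem natCast_pow_rpow_le (α : ℝ) (m K : ℕ) :
    (((m + 1) ^ K : ℕ) : ENNReal) ^ α ≤ ((m + 1 : ℕ) : ENNReal) ^ (K * ⌈α⌉₊) := by
  rw [Nat.cast_pow, ← ENNReal.rpow_natCast, ← ENNReal.rpow_mul, ← ENNReal.rpow_natCast]
  refine ENNReal.rpow_le_rpow_of_exponent_le (by simp) ?_
  push_cast
  exact mul_le_mul_of_nonneg_left (Nat.le_ceil α) K.cast_nonneg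

/-- Data processing of the sandwiched Rényi divergence under measurements. -/
theorem measuredSum_le_sandwichedQ {κ : Type} [Fintype κ] {α : ℝ} (hα : 1 < α) {ρ σ : Op Z}
    (hρ : ρ.PosSemidef) (hσ : σ.PosSemidef) (hs : SuppLE ρ σ) {E : κ → Op Z}
    (hE : IsSubPOVM E) :
    measuredSum α E ρ σ ≤ ENNReal.ofReal (sandwichedQ α ρ σ) := by
  have hQ : 0 ≤ sandwichedQ α ρ σ :=
    trace_re_nonneg (opPow_posSemidef (sandwiched_posSemidef hρ hσ _) α)
  -- Tensor-power trick: both sides are multiplicative under `m` copies and the pinching loss is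
  -- only polynomial in `m`.
  refine le_of_pow_le_polynomial_mul_pow hQ (Fintype.card Z * ⌈α⌉₊) fun m => ?_
  rw [← measuredSum_piTensor hE hρ hσ m]
  have h := diagonalizes_of_isHermitian hσ.1
  refine (measuredSum_le_card_mul hα (piTensor_posSemidef fun _ => hρ)
    (piTensor_posSemidef fun _ => hσ) (suppLE_opTensorPow hσ hs m) (h.piTensor (ι := Fin m))
    (card_image_prod_le _ m) (hE.piTensor m)).trans ?_
  rw [sandwichedQ_opTensorPow hρ hσ, ENNReal.ofReal_pow hQ]
  exact mul_le_mul_left (natCast_pow_rpow_le α m _) _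

end Power

/-! ## Bounding one use of the channels -/

section Divergence

variable {X Y : Type*} [Fintype X] [DecidableEq X] [Fintype Y] [DecidableEq Y]

theorem sandwichedDiv_le_coe {α : ℝ} (hα : 1 < α) {ρ σ : Op X} {D : ℝ}
    (h : sandwichedDiv α ρ σ ≤ (D : EReal)) :
    SuppLE ρ σ ∧ sandwichedQ α ρ σ ≤ 2 ^ ((α - 1) * D) := by
  unfold sandwichedDiv at h
  split_ifs at h with hs
  · refine ⟨hs, ?_⟩
    change _ * log2 (sandwichedQ α ρ σ) ≤ _ at h
    unfold log2 at h
    split_ifs at h with h0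
    · exact h0.trans (by positivity)
    · push Not at h0
      rw [← EReal.coe_mul, EReal.coe_le_coe_iff, one_div, inv_mul_le_iff₀ (by linarith)] at h
      exact (Real.logb_le_iff_le_rpow (by norm_num) h0).1 h
  · simp at h

/-- The operator `ω^{1/2} J^N ω^{1/2}`. -/
noncomputable def weightedChoi (N : SuperOp X Y) (ω : Op X) : Op (X × Y) :=
  (opPow ω (1 / 2) ⊗ₖ (1 : Op Y)) * choi N * (opPow ω (1 / 2) ⊗ₖ (1 : Op Y))

theorem weightedChoi_posSemidef {N : SuperOp X Y} (hN : HasKraus N) {ω : Op X}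
    (hω : ω.PosSemidef) : (weightedChoi N ω).PosSemidef := by
  have := hN.posSemidef_choi.mul_mul_conjTranspose_same (opPow ω (1 / 2) ⊗ₖ (1 : Op Y))
  rwa [conjTranspose_kronecker, conjTranspose_one, (opPow_isHermitian hω.1 _).eq] at this

theorem measuredSum_weightedChoi_le {κ : Type} [Fintype κ] {α : ℝ} (hα : 1 < α)
    {N M : SuperOp X Y} (hN : HasKraus N) (hM : HasKraus M) {D : ℝ}
    (hD : channelDiv α N M ≤ (D : EReal)) {ω : Op X} (hω : IsDensity ω) {E : κ → Op (X × Y)}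
    (hE : IsSubPOVM E) :
    measuredSum α E (weightedChoi N ω) (weightedChoi M ω) ≤
      ENNReal.ofReal (2 ^ ((α - 1) * D)) := by
  have h : sandwichedDiv α (weightedChoi N ω) (weightedChoi M ω) ≤ (D : EReal) :=
    (le_iSup₂ (f := fun (ω : Op X) (_ : IsDensity ω) =>
      sandwichedDiv α (weightedChoi N ω) (weightedChoi M ω)) ω hω).trans hD
  obtain ⟨hs, hQ⟩ := sandwichedDiv_le_coe hα h
  exact (measuredSum_le_sandwichedQ hα (weightedChoi_posSemidef hN hω.1)
    (weightedChoi_posSemidef hM hω.1) hs hE).trans (ENNReal.ofReal_le_ofReal hQ)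

/-- A polar decomposition `K = V (Kᴴ K)^{1/2}` with a contraction `V`. -/
theorem exists_polar {R : Type*} [Fintype R] [DecidableEq R] (K : Matrix R X ℂ) :
    ∃ V : Matrix R X ℂ, K = V * opPow (Kᴴ * K) (1 / 2) ∧ (1 - Vᴴ * V).PosSemidef := by
  set ω := Kᴴ * K with hω_def
  have hω : ω.PosSemidef := posSemidef_conjTranspose_mul_self K
  have hω1 : ω * (opPow ω (-(1 / 2)) * opPow ω (1 / 2)) = ω := by
    have := mul_opPow_mul_opPow_neg hω (-(1 / 2))
    rwa [neg_neg] at this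
  refine ⟨K * opPow ω (-(1 / 2)), ?_, ?_⟩
  · have h0 : K * (1 - opPow ω (-(1 / 2)) * opPow ω (1 / 2)) = 0 := by
      -- `K` vanishes on the kernel of `ω = Kᴴ K`, so `V = K ω^{-1/2}` with the generalized inverse
      -- loses nothing.
      rw [← conjTranspose_mul_self_eq_zero, conjTranspose_mul, Matrix.mul_assoc,
        ← Matrix.mul_assoc Kᴴ, ← hω_def, Matrix.mul_sub ω, hω1]
      simp
    rw [Matrix.mul_sub, Matrix.mul_one, sub_eq_zero] at h0
    rw [Matrix.mul_assoc]
    exact h0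
  · have h1 : (K * opPow ω (-(1 / 2)))ᴴ * (K * opPow ω (-(1 / 2))) =
        opPow ω (-(1 / 2)) * opPow ω (1 / 2) := by
      rw [conjTranspose_mul, (opPow_isHermitian hω.1 _).eq, Matrix.mul_assoc,
        ← Matrix.mul_assoc Kᴴ, ← hω_def]
      congr 1
      conv_lhs => enter [1]; rw [← opPow_one hω.1]
      rw [opPow_mul_opPow hω (by norm_num)]
      norm_num
    rw [h1]
    have := one_sub_support_posSemidef hω (s := -(1 / 2)) (by norm_num)
    rwa [neg_neg] at this

/-- The defect splits as `Lᴴ (1 - ∑ E) L + (1 - Lᴴ L)`. Stability under mere contractions is the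
reason for working with families summing to at most the identity. -/
theorem IsSubPOVM.conj {κ : Type*} [Fintype κ] {E : κ → Op Y} (hE : IsSubPOVM E)
    {L : Matrix Y X ℂ} (hL : (1 - Lᴴ * L).PosSemidef) : IsSubPOVM fun x => Lᴴ * E x * L where
  posSemidef x := (hE.posSemidef x).conjTranspose_mul_mul_same L
  sum_le_one := by
    have : 1 - ∑ x, Lᴴ * E x * L = Lᴴ * (1 - ∑ x, E x) * L + (1 - Lᴴ * L) := by
      rw [Matrix.mul_sub, Matrix.sub_mul, Matrix.mul_sum, Matrix.sum_mul, Matrix.mul_one]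
      abel
    rw [this]
    exact (hE.sum_le_one.conjTranspose_mul_mul_same L).add hL

/-- The pullback of a measurement along a channel. -/
theorem IsSubPOVM.exists_pullback {κ : Type*} [Fintype κ] {E : κ → Op Y} (hE : IsSubPOVM E)
    {F : SuperOp X Y} (hF : HasKraus F) (hF1 : ∀ W, (F W).trace = W.trace) :
    ∃ E' : κ → Op X, IsSubPOVM E' ∧ ∀ x W, (E x * F W).trace = (E' x * W).trace := by
  obtain ⟨r, A, rfl⟩ := hF
  have htr (T : Op Y) (W : Op X) :
      (T * krausMap A W).trace = ((∑ k, (A k)ᴴ * T * A k) * W).trace := by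
    rw [krausMap_apply, Matrix.mul_sum, Matrix.sum_mul, trace_sum, trace_sum]
    refine Finset.sum_congr rfl fun k _ => ?_
    rw [← Matrix.mul_assoc, trace_mul_comm, ← Matrix.mul_assoc, ← Matrix.mul_assoc]
  -- Trace preservation says exactly that the adjoint map is unital.
  have h1 : ∑ k, (A k)ᴴ * A k = 1 := by
    refine Matrix.ext_iff_trace_mul_right.2 fun W => ?_
    have := htr 1 W
    simp only [Matrix.one_mul, Matrix.mul_one] at this
    rw [Matrix.one_mul, ← this, hF1]
  refine ⟨fun x => ∑ k, (A k)ᴴ * E x * A k, ⟨fun x => posSemidef_sum _ fun k _ =>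
    (hE.posSemidef x).conjTranspose_mul_mul_same _, ?_⟩, fun x W => htr _ W⟩
  have : 1 - ∑ x, ∑ k, (A k)ᴴ * E x * A k = ∑ k, (A k)ᴴ * (1 - ∑ x, E x) * A k := by
    rw [Finset.sum_comm, ← h1]
    simp only [Matrix.mul_sub, Matrix.sub_mul, Matrix.mul_one, Finset.sum_sub_distrib,
      Matrix.mul_sum, Matrix.sum_mul]
  rw [this]
  exact posSemidef_sum _ fun k _ => hE.sum_le_one.conjTranspose_mul_mul_same _

end Divergence

/-! ### Pure inputs with reference systems, and the chain rule -/

section Middle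

variable {A B X Y : Type*} [Fintype A] [DecidableEq A] [Fintype B] [DecidableEq B]
  [Fintype X] [DecidableEq X] [Fintype Y] [DecidableEq Y]

/-- Separating the reference systems from the channel inputs. -/
def splitInput (A B X : Type*) (m : ℕ) :
    (Fin m → (A × X) × B) ≃ (Fin m → A × B) × (Fin m → X) where
  toFun u := (fun i => ((u i).1.1, (u i).2), fun i => (u i).1.2)
  invFun q := fun i => (((q.1 i).1, q.2 i), (q.1 i).2)
  left_inv _ := rfl
  right_inv _ := rfl

/-- Separating the reference systems from the channel outputs. -/
def splitOutput (A B Y : Type*) (m : ℕ) :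
    (Fin m → A × (Y × B)) ≃ (Fin m → A × B) × (Fin m → Y) where
  toFun p := (fun i => ((p i).1, (p i).2.2), fun i => (p i).2.1)
  invFun q := fun i => ((q.1 i).1, (q.2 i, (q.1 i).2))
  left_inv _ := rfl
  right_inv _ := rfl

/-- A pure input shared with the reference systems `A B` is read as a matrix `K` from channel inputs
to references. The reference indices pass through unchanged, so the sums collapse to channel inputs
and leave the Choi operator conjugated by `K ⊗ 1`. -/
theorem tensorPower_applyMiddle_vecMulVec (N : SuperOp X Y) {m : ℕ}
    (e : (Fin m → (A × X) × B) → ℂ) (K : Matrix (Fin m → A × B) (Fin m → X) ℂ)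
    (hK : K = of fun r x => e ((splitInput A B X m).symm (r, x))) :
    tensorPower (applyMiddle A B N) m (vecMulVec e (star e)) =
      ((K ⊗ₖ (1 : Op (Fin m → Y))) * choi (tensorPower N m) *
        (K ⊗ₖ (1 : Op (Fin m → Y)))ᴴ).submatrix (splitOutput A B Y m) (splitOutput A B Y m) := by
  ext p q
  rw [tensorPower_apply, submatrix_apply]
  simp only [applyMiddle_single]
  have hprod (u v : Fin m → (A × X) × B) :
      (∏ i, if ((u i).1.1 = (p i).1 ∧ (u i).2 = (p i).2.2) ∧
          ((v i).1.1 = (q i).1 ∧ (v i).2 = (q i).2.2) then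
        N (single (u i).1.2 (v i).1.2 1) (p i).2.1 (q i).2.1 else 0) =
      if (splitInput A B X m u).1 = (splitOutput A B Y m p).1 ∧
          (splitInput A B X m v).1 = (splitOutput A B Y m q).1 then
        ∏ i, N (single (u i).1.2 (v i).1.2 1) (p i).2.1 (q i).2.1 else 0 := by
    split_ifs with h
    · refine Finset.prod_congr rfl fun i _ => ?_
      have h1 := congrFun h.1 i
      have h2 := congrFun h.2 i
      simp only [splitInput, splitOutput, Equiv.coe_fn_mk, Prod.mk.injEq] at h1 h2
      rw [if_pos ⟨h1, h2⟩]
    · have : ∃ i, ¬(((u i).1.1 = (p i).1 ∧ (u i).2 = (p i).2.2) ∧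
          ((v i).1.1 = (q i).1 ∧ (v i).2 = (q i).2.2)) := by
        by_contra hc
        push Not at hc
        refine h ⟨funext fun i => ?_, funext fun i => ?_⟩
        · exact Prod.ext (hc i).1.1 (hc i).1.2
        · exact Prod.ext (hc i).2.1 (hc i).2.2
      obtain ⟨i, hi⟩ := this
      exact Finset.prod_eq_zero (Finset.mem_univ i) (if_neg hi)
  simp only [hprod]
  set gi := splitInput A B X m
  set pr := (splitOutput A B Y m p).1
  set qr := (splitOutput A B Y m q).1
  rw [← gi.symm.sum_comp, Fintype.sum_prod_type, Finset.sum_eq_single pr, Matrix.mul_assoc]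
  rotate_left
  · intro r _ hr
    refine Finset.sum_eq_zero fun x _ => Finset.sum_eq_zero fun v _ => ?_
    rw [Equiv.apply_symm_apply, if_neg (fun h => hr h.1), mul_zero]
  · simp
  have hp : splitOutput A B Y m p = (pr, fun i => (p i).2.1) := rfl
  have hq : splitOutput A B Y m q = (qr, fun i => (q i).2.1) := rfl
  rw [hp, hq, Matrix.mul_apply, Fintype.sum_prod_type]
  refine Finset.sum_congr rfl fun x _ => ?_
  rw [Finset.sum_eq_single (fun i => (p i).2.1)]
  rotate_left
  · intro y _ hy
    rw [kroneckerMap_apply, one_apply_ne hy.symm, mul_zero, zero_mul]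
  · simp
  rw [kroneckerMap_apply, one_apply_eq, mul_one, ← gi.symm.sum_comp, Fintype.sum_prod_type,
    Finset.sum_eq_single qr, Matrix.mul_apply, Fintype.sum_prod_type, Finset.mul_sum]
  rotate_left
  · intro r _ hr
    refine Finset.sum_eq_zero fun v _ => ?_
    rw [Equiv.apply_symm_apply, Equiv.apply_symm_apply, if_neg (fun h => hr h.2), mul_zero]
  · simp
  refine Finset.sum_congr rfl fun x' _ => ?_
  rw [Finset.sum_eq_single (fun i => (q i).2.1)]
  rotate_left
  · intro y _ hy
    rw [conjTranspose_apply, kroneckerMap_apply, one_apply_ne hy.symm, mul_zero, star_zero,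
      mul_zero]
  · simp
  rw [conjTranspose_apply, kroneckerMap_apply, one_apply_eq, mul_one, Equiv.apply_symm_apply,
    Equiv.apply_symm_apply, if_pos ⟨rfl, rfl⟩, choi_apply, tensorPower_single, vecMulVec_apply, hK]
  simp only [piTensor, of_apply, Pi.star_apply]
  have hx (r : Fin m → A × B) (x : Fin m → X) (i : Fin m) : (gi.symm (r, x) i).1.2 = x i := rfl
  simp only [hx]
  ring

/-- Write `K = V ω^{1/2}` with `ω = Kᴴ K`, a density operator because `e` is normalized. Both
outputs are then weighted Choi operators conjugated by the same contraction, which is moved into the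
measurement; `ω` is admissible in the supremum defining the channel divergence. -/
theorem measuredSum_applyMiddle_le {κ : Type} [Fintype κ] {α : ℝ} (hα : 1 < α)
    {N M : SuperOp X Y} (hN : HasKraus N) (hM : HasKraus M) {m : ℕ} {D : ℝ}
    (hD : channelDiv α (tensorPower N m) (tensorPower M m) ≤ (D : EReal))
    (e : (Fin m → (A × X) × B) → ℂ) (he : (vecMulVec e (star e)).trace = 1)
    {E : κ → Op (Fin m → A × (Y × B))} (hE : IsSubPOVM E) :
    ∑ x, renyiWeight α
        (E x * tensorPower (applyMiddle A B N) m (vecMulVec e (star e))).trace.re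
        (E x * tensorPower (applyMiddle A B M) m (vecMulVec e (star e))).trace.re ≤
      ENNReal.ofReal (2 ^ ((α - 1) * D)) := by
  set K : Matrix (Fin m → A × B) (Fin m → X) ℂ :=
    of fun r x => e ((splitInput A B X m).symm (r, x)) with hK
  obtain ⟨V, hV, hV1⟩ := exists_polar K
  set ω := Kᴴ * K
  have hω : IsDensity ω := by
    refine ⟨posSemidef_conjTranspose_mul_self K, ?_⟩
    rw [← he, trace_mul_comm, trace, trace, ← (splitInput A B X m).symm.sum_comp,
      Fintype.sum_prod_type]
    refine Finset.sum_congr rfl fun r _ => ?_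
    rw [diag_apply, Matrix.mul_apply]
    rfl
  set f := splitOutput A B Y m
  set L : Matrix (Fin m → A × (Y × B)) ((Fin m → X) × (Fin m → Y)) ℂ :=
    (V ⊗ₖ (1 : Op (Fin m → Y))).submatrix f id
  have hL : (1 - Lᴴ * L).PosSemidef := by
    have : Lᴴ * L = (Vᴴ * V) ⊗ₖ (1 : Op (Fin m → Y)) := by
      simp only [L]
      rw [conjTranspose_submatrix, ← submatrix_mul _ _ id f id f.bijective, submatrix_id_id,
        conjTranspose_kronecker, ← mul_kronecker_mul, conjTranspose_one, Matrix.one_mul]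
    have h2 : 1 - Lᴴ * L = (1 - Vᴴ * V) ⊗ₖ (1 : Op (Fin m → Y)) := by
      rw [this, ← one_kronecker_one]
      ext p q
      simp only [Matrix.sub_apply, kroneckerMap_apply]
      ring
    rw [h2]
    exact hV1.kronecker PosSemidef.one
  have hmap (G : SuperOp X Y) : tensorPower (applyMiddle A B G) m (vecMulVec e (star e)) =
      L * weightedChoi (tensorPower G m) ω * Lᴴ := by
    rw [tensorPower_applyMiddle_vecMulVec G e K hK]
    conv_lhs => rw [hV]
    have h1 : (V * opPow ω (1 / 2)) ⊗ₖ (1 : Op (Fin m → Y)) =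
        (V ⊗ₖ (1 : Op (Fin m → Y))) * (opPow ω (1 / 2) ⊗ₖ (1 : Op (Fin m → Y))) := by
      rw [← mul_kronecker_mul, Matrix.one_mul]
    rw [h1, conjTranspose_mul, conjTranspose_kronecker (opPow ω (1 / 2)),
      (opPow_isHermitian hω.1.1 _).eq, conjTranspose_one]
    simp only [L, weightedChoi]
    rw [conjTranspose_submatrix]
    have h2 (T : Op ((Fin m → X) × (Fin m → Y))) :
        (V ⊗ₖ (1 : Op (Fin m → Y))).submatrix f id * T *
          ((V ⊗ₖ (1 : Op (Fin m → Y)))ᴴ).submatrix id f =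
        ((V ⊗ₖ (1 : Op (Fin m → Y))) * T * (V ⊗ₖ (1 : Op (Fin m → Y)))ᴴ).submatrix f f := rfl
    rw [h2]
    simp only [Matrix.mul_assoc, f]
  have htr (T : Op (Fin m → A × (Y × B))) (S : Op ((Fin m → X) × (Fin m → Y))) :
      (T * (L * S * Lᴴ)).trace = (Lᴴ * T * L * S).trace := by
    rw [← Matrix.mul_assoc, trace_mul_comm]
    simp only [Matrix.mul_assoc]
  simp only [hmap, htr]
  exact measuredSum_weightedChoi_le hα (hN.tensorPower m) (hM.tensorPower m) hD hω (hE.conj hL)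

/-- The measured Rényi sums of `m` copies of `ρ` and `σ` are at most `c`. -/
def MeasuredBound {Z : Type*} [Fintype Z] [DecidableEq Z] (α : ℝ) (m : ℕ) (ρ σ : Op Z)
    (c : ENNReal) : Prop :=
  ∀ (r : ℕ) (E : Fin r → Op (Fin m → Z)), IsSubPOVM E →
    measuredSum α E (opTensorPow ρ m) (opTensorPow σ m) ≤ c

theorem isSubPOVM_colProj {Z J : Type*} [Fintype Z] [DecidableEq Z] [Fintype J] [DecidableEq J]
    {U : Matrix Z J ℂ} (hU : U * Uᴴ = 1) {r : ℕ} (f : Fin r ≃ J) :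
    IsSubPOVM fun j => colProj U (f j) where
  posSemidef j := colProj_posSemidef U _
  sum_le_one := by
    rw [f.sum_comp]
    have := mul_diagonal_mul_conjTranspose U 1
    simp only [Pi.one_apply, one_smul] at this
    rw [← this]
    have h1 : diagonal (1 : J → ℂ) = 1 := diagonal_one
    rw [h1, Matrix.mul_one, hU, sub_self]
    exact PosSemidef.zero

theorem trace_colProj_mul {Z J : Type*} [Fintype Z] (U : Matrix Z J ℂ) (W : Op Z) (j : J) :
    (colProj U j * W).trace = (Uᴴ * W * U) j j := by
  rw [colProj, vecMulVec_mul, trace_vecMulVec, Matrix.mul_apply, dotProduct]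
  refine Finset.sum_congr rfl fun z _ => ?_
  rw [mul_comm]
  rfl

/-- One round of the protocol multiplies the measured bound by a polynomial in `m` and by the
exponential of the channel divergence. -/
theorem MeasuredBound.step {O : Type*} [Fintype O] [DecidableEq O] {α : ℝ} (hα : 1 < α)
    {N M : SuperOp X Y} (hN : HasKraus N) (hM : HasKraus M) {m : ℕ} {D : ℝ}
    (hD : channelDiv α (tensorPower N m) (tensorPower M m) ≤ (D : EReal))
    {F : SuperOp (A × (Y × B)) O} (hF : HasKraus F) (hF1 : ∀ W, (F W).trace = W.trace)
    {ρ σ : Op ((A × X) × B)} (hρ : ρ.PosSemidef) (hσ : σ.PosSemidef) {c : ENNReal}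
    (h : MeasuredBound α m ρ σ c) :
    MeasuredBound α m (F (applyMiddle A B N ρ)) (F (applyMiddle A B M σ))
      (((m + 1 : ℕ) : ENNReal) ^ (Fintype.card ((A × X) × B) * ⌈α⌉₊) *
        (c * ENNReal.ofReal (2 ^ ((α - 1) * D)))) := by
  intro r E hE
  have hd := diagonalizes_of_isHermitian hσ.1
  -- The functionals for the two arguments differ here: `f N` is applied to `ρ^{⊗m}` and `f M` to
  -- `σ^{⊗m}`, each including its own map.
  obtain ⟨U, hU, key⟩ := (hd.piTensor (ι := Fin m)).exists_sum_renyiWeight_le hα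
    (piTensor_posSemidef fun _ => hρ) (piTensor_posSemidef fun _ => hσ) (card_image_prod_le _ m)
  set d : (Fin m → (A × X) × B) → ℝ := fun y => ∏ i, hσ.1.eigenvalues (y i)
  have hG {G : SuperOp X Y} (τ : Op ((A × X) × B)) :
      opTensorPow (F (applyMiddle A B G τ)) m =
        tensorPower F m (tensorPower (applyMiddle A B G) m (opTensorPow τ m)) := by
    rw [tensorPower_piTensor, tensorPower_piTensor]
  let f (G : SuperOp X Y) (x : Fin r) : Op (Fin m → (A × X) × B) →ₗ[ℝ] ℝ :=
    effectFun (E x) ∘ₗ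
      ((tensorPower F m ∘ₗ tensorPower (applyMiddle A B G) m).restrictScalars ℝ)
  have hf {G : SuperOp X Y} (hG : HasKraus G) (x : Fin r) (W : Op (Fin m → (A × X) × B))
      (hW : W.PosSemidef) : 0 ≤ f G x W :=
    trace_mul_re_nonneg (hE.posSemidef x)
      (((hF.tensorPower m).comp ((hG.applyMiddle A B).tensorPower m)).posSemidef hW)
  unfold measuredSum
  rw [hG, hG]
  refine (key (f N) (f M) (hf hN) (hf hM)).trans ?_
  refine mul_le_mul' (natCast_pow_rpow_le α m _) ?_
  obtain ⟨E', hE', htr⟩ := hE.exists_pullback (hF.tensorPower m) (trace_tensorPower hF1 m)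
  have hinner (j : Fin m → (A × X) × B) :
      ∑ x, renyiWeight α (f N x (colProj U j)) (f M x (colProj U j)) ≤
        ENNReal.ofReal (2 ^ ((α - 1) * D)) := by
    have h1 (G : SuperOp X Y) (x : Fin r) : f G x (colProj U j) =
        (E' x * tensorPower (applyMiddle A B G) m (colProj U j)).trace.re :=
      congrArg Complex.re (htr x _)
    simp only [h1]
    exact measuredSum_applyMiddle_le hα hN hM hD _ (trace_colProj hU.conjTranspose_mul_self j) hE'
  -- The outer weights are outcome weights of the measurement in the eigenbasis `U`, to which the
  -- hypothesis on the previous pair applies.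
  have houter : ∑ j, renyiWeight α ((Uᴴ * opTensorPow ρ m * U) j j).re (d j) ≤ c := by
    set g := (Fintype.equivFin (Fin m → (A × X) × B)).symm
    refine le_of_eq_of_le ?_ (h _ _ (isSubPOVM_colProj hU.mul_conjTranspose_self g))
    unfold measuredSum
    rw [← g.sum_comp]
    refine Finset.sum_congr rfl fun j _ => ?_
    rw [trace_colProj_mul, trace_colProj_mul, hU.conj_eq, diagonal_apply_eq, Complex.ofReal_re]
  calc _ ≤ ∑ j, renyiWeight α ((Uᴴ * opTensorPow ρ m * U) j j).re (d j) *
        ENNReal.ofReal (2 ^ ((α - 1) * D)) :=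
        Finset.sum_le_sum fun j _ => mul_le_mul_right (hinner j) _
    _ ≤ _ := by
        rw [← Finset.sum_mul]
        exact mul_le_mul_left houter _

end Middle

/-! ## Superadditivity of the channel divergence and existence of the regularization -/

section Superadditive

variable {X Y X' Y' : Type*} [Fintype X] [DecidableEq X] [Fintype Y] [DecidableEq Y]
  [Fintype X'] [DecidableEq X'] [Fintype Y'] [DecidableEq Y']

theorem sandwichedQ_kronecker {α : ℝ} {ρ σ : Op X} {ρ' σ' : Op X'} (hρ : ρ.PosSemidef)
    (hσ : σ.PosSemidef) (hρ' : ρ'.PosSemidef) (hσ' : σ'.PosSemidef) :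
    sandwichedQ α (ρ ⊗ₖ ρ') (σ ⊗ₖ σ') = sandwichedQ α ρ σ * sandwichedQ α ρ' σ' := by
  unfold sandwichedQ
  have hC := sandwiched_posSemidef hρ hσ ((1 - α) / (2 * α))
  have hC' := sandwiched_posSemidef hρ' hσ' ((1 - α) / (2 * α))
  rw [opPow_kronecker hσ hσ', ← mul_kronecker_mul, ← mul_kronecker_mul, opPow_kronecker hC hC',
    trace_kronecker, trace_eq_re (opPow_posSemidef hC α), trace_eq_re (opPow_posSemidef hC' α),
    ← Complex.ofReal_mul, Complex.ofReal_re, Complex.ofReal_re, Complex.ofReal_re]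

omit [DecidableEq X] in
theorem exists_mulVec_ne_zero {T : Op X} (hT : T ≠ 0) : ∃ w x, T.mulVec w x ≠ 0 := by
  classical
  by_contra hc
  push Not at hc
  refine hT (Matrix.ext_of_mulVec_single fun i => ?_)
  ext z
  rw [hc]
  simp

theorem suppLE_kronecker_iff {ρ σ : Op X} {ρ' σ' : Op X'} (hσ : σ.PosSemidef)
    (hσ' : σ'.PosSemidef) (hρ0 : ρ ≠ 0) (hρ0' : ρ' ≠ 0) :
    SuppLE (ρ ⊗ₖ ρ') (σ ⊗ₖ σ') ↔ SuppLE ρ σ ∧ SuppLE ρ' σ' := by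
  have hmul (S : Op X) (T : Op X') (v : X → ℂ) (w : X' → ℂ) :
      (S ⊗ₖ T).mulVec (fun p => v p.1 * w p.2) = fun p => S.mulVec v p.1 * T.mulVec w p.2 := by
    ext p
    simp only [mulVec, dotProduct, kroneckerMap_apply, Fintype.sum_prod_type, Finset.sum_mul_sum]
    refine Finset.sum_congr rfl fun x _ => Finset.sum_congr rfl fun x' _ => ?_
    ring
  constructor
  · intro h
    constructor
    · intro v hv
      -- A vector not killed by `ρ'` lets the product vector detect `ρ v`; this is where the factors
      -- must be nonzero.
      obtain ⟨w, z, hz⟩ := exists_mulVec_ne_zero hρ0'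
      have h1 := h (fun p => v p.1 * w p.2) (by rw [hmul, hv]; ext; simp)
      rw [hmul] at h1
      ext x
      exact (mul_eq_zero.1 (congrFun h1 (x, z))).resolve_right hz
    · intro w hw
      obtain ⟨v, z, hz⟩ := exists_mulVec_ne_zero hρ0
      have h1 := h (fun p => v p.1 * w p.2) (by rw [hmul, hw]; ext; simp)
      rw [hmul] at h1
      ext x
      exact (mul_eq_zero.1 (congrFun h1 (z, x))).resolve_left hz
  · rintro ⟨h, h'⟩
    obtain ⟨K, hK⟩ := (suppLE_iff hσ).1 h
    obtain ⟨K', hK'⟩ := (suppLE_iff hσ').1 h'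
    refine (suppLE_iff (hσ.kronecker hσ')).2 ⟨K ⊗ₖ K', ?_⟩
    rw [← mul_kronecker_mul, ← hK, ← hK']

/-- Data processing for the trivial measurement bounds it below by the Rényi weight of `1` and `tr
σ`, which is positive. Hence the logarithm never takes the value `⊥`. -/
theorem sandwichedQ_pos {α : ℝ} (hα : 1 < α) {ρ σ : Op X} (hρ : IsDensity ρ)
    (hσ : σ.PosSemidef) (hs : SuppLE ρ σ) : 0 < sandwichedQ α ρ σ := by
  have hE : IsSubPOVM fun _ : Unit => (1 : Op X) :=
    ⟨fun _ => PosSemidef.one, by simpa using PosSemidef.zero⟩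
  have := measuredSum_le_sandwichedQ hα hρ.1 hσ hs hE
  have hpos : 0 < measuredSum α (fun _ : Unit => (1 : Op X)) ρ σ := by
    simp only [measuredSum, Finset.univ_unique, Finset.sum_singleton, Matrix.one_mul, hρ.2]
    exact renyiWeight_pos hα (by simp) _
  simpa using hpos.trans_le this

theorem log2_of_pos {x : ℝ} (hx : 0 < x) : log2 x = ((Real.logb 2 x : ℝ) : EReal) :=
  if_neg (not_le.2 hx)

theorem sandwichedDiv_of_suppLE {α : ℝ} (hα : 1 < α) {ρ σ : Op X} (hρ : IsDensity ρ)
    (hσ : σ.PosSemidef) (hs : SuppLE ρ σ) : sandwichedDiv α ρ σ =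
      ((1 / (α - 1) * Real.logb 2 (sandwichedQ α ρ σ) : ℝ) : EReal) := by
  rw [sandwichedDiv, if_pos hs, EReal.coe_mul, ← log2_of_pos (sandwichedQ_pos hα hρ hσ hs)]
  rfl

theorem sandwichedDiv_ne_bot {α : ℝ} (hα : 1 < α) {ρ σ : Op X} (hρ : IsDensity ρ)
    (hσ : σ.PosSemidef) : sandwichedDiv α ρ σ ≠ ⊥ := by
  by_cases hs : SuppLE ρ σ
  · rw [sandwichedDiv_of_suppLE hα hρ hσ hs]
    exact EReal.coe_ne_bot _
  · rw [sandwichedDiv, if_neg hs]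
    exact top_ne_bot

omit [DecidableEq X] in
theorem IsDensity.ne_zero {ρ : Op X} (hρ : IsDensity ρ) : ρ ≠ 0 := by
  rintro rfl
  simpa using hρ.2

omit [DecidableEq X] [DecidableEq X'] in
theorem IsDensity.kronecker {ρ : Op X} {ρ' : Op X'} (hρ : IsDensity ρ) (hρ' : IsDensity ρ') :
    IsDensity (ρ ⊗ₖ ρ') :=
  ⟨hρ.1.kronecker hρ'.1, by rw [trace_kronecker, hρ.2, hρ'.2, one_mul]⟩

omit [DecidableEq X] [DecidableEq X'] in
theorem IsDensity.submatrix {ρ : Op X} (hρ : IsDensity ρ) (e : X' ≃ X) :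
    IsDensity (ρ.submatrix e e) :=
  ⟨hρ.1.submatrix e, by rw [← hρ.2]; exact e.sum_comp fun x => ρ x x⟩

theorem sandwichedDiv_kronecker {α : ℝ} (hα : 1 < α) {ρ σ : Op X} {ρ' σ' : Op X'}
    (hρ : IsDensity ρ) (hσ : σ.PosSemidef) (hρ' : IsDensity ρ') (hσ' : σ'.PosSemidef) :
    sandwichedDiv α ρ σ + sandwichedDiv α ρ' σ' ≤ sandwichedDiv α (ρ ⊗ₖ ρ') (σ ⊗ₖ σ') := by
  by_cases h : SuppLE (ρ ⊗ₖ ρ') (σ ⊗ₖ σ')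
  · obtain ⟨h1, h2⟩ := (suppLE_kronecker_iff hσ hσ' hρ.ne_zero hρ'.ne_zero).1 h
    rw [sandwichedDiv_of_suppLE hα hρ hσ h1, sandwichedDiv_of_suppLE hα hρ' hσ' h2,
      sandwichedDiv_of_suppLE hα (hρ.kronecker hρ') (hσ.kronecker hσ') h,
      sandwichedQ_kronecker hρ.1 hσ hρ'.1 hσ', Real.logb_mul (sandwichedQ_pos hα hρ hσ h1).ne'
        (sandwichedQ_pos hα hρ' hσ' h2).ne', mul_add, EReal.coe_add]
  · conv_rhs => rw [sandwichedDiv, if_neg h]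
    exact le_top

theorem sandwichedDiv_submatrix (α : ℝ) {ρ σ : Op X} (hρ : ρ.PosSemidef) (hσ : σ.PosSemidef)
    (e : X' ≃ X) : sandwichedDiv α (ρ.submatrix e e) (σ.submatrix e e) = sandwichedDiv α ρ σ := by
  have hs : SuppLE (ρ.submatrix e e) (σ.submatrix e e) ↔ SuppLE ρ σ := by
    have hmul (T : Op X) (v : X' → ℂ) :
        (T.submatrix e e).mulVec v = (T.mulVec (v ∘ e.symm)) ∘ e := by
      rw [submatrix_mulVec_equiv]
    constructor
    · intro h v hv
      have h1 := h (v ∘ e) (by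
        rw [hmul, Function.comp_assoc, e.self_comp_symm, Function.comp_id, hv]; rfl)
      rw [hmul, Function.comp_assoc, e.self_comp_symm, Function.comp_id] at h1
      ext x
      simpa using congrFun h1 (e.symm x)
    · intro h v hv
      rw [hmul] at hv ⊢
      rw [h]
      · rfl
      · ext x
        simpa using congrFun hv (e.symm x)
  have hQ : sandwichedQ α (ρ.submatrix e e) (σ.submatrix e e) = sandwichedQ α ρ σ := by
    unfold sandwichedQ
    rw [opPow_submatrix hσ.1, submatrix_mul_equiv, submatrix_mul_equiv,
      opPow_submatrix (sandwiched_posSemidef hρ hσ _).1]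
    exact congrArg Complex.re (e.sum_comp fun x => opPow _ α x x)
  by_cases h : SuppLE ρ σ
  · rw [sandwichedDiv, sandwichedDiv, if_pos h, if_pos (hs.2 h)]
    exact congrArg (fun t => _ * log2 t) hQ
  · rw [sandwichedDiv, sandwichedDiv, if_neg h, if_neg (mt hs.1 h)]

/-- By cyclicity the trace of `ω^{1/2} J^N ω^{1/2}` is `tr N(ωᵀ)`, so trace preservation of `N`
gives one. -/
theorem isDensity_weightedChoi {N : SuperOp X Y} (hN : HasKraus N)
    (hN1 : ∀ W, (N W).trace = W.trace) {ω : Op X} (hω : IsDensity ω) :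
    IsDensity (weightedChoi N ω) := by
  refine ⟨weightedChoi_posSemidef hN hω.1, ?_⟩
  have hS : (opPow ω (1 / 2) ⊗ₖ (1 : Op Y)) * (opPow ω (1 / 2) ⊗ₖ (1 : Op Y)) =
      ω ⊗ₖ (1 : Op Y) := by
    rw [← mul_kronecker_mul, opPow_mul_opPow hω.1 (by norm_num), Matrix.one_mul]
    norm_num [opPow_one hω.1.1]
  rw [weightedChoi, trace_mul_comm, ← Matrix.mul_assoc, hS, ← hω.2, ← trace_transpose ω, ← hN1 ωᵀ]
  simp only [trace, diag_apply, superOp_apply_eq_sum N ωᵀ, transpose_apply, Matrix.mul_apply,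
    Fintype.sum_prod_type, kroneckerMap_apply, choi_apply, one_apply]
  rw [Finset.sum_comm]
  refine Finset.sum_congr rfl fun y _ => ?_
  rw [Finset.sum_comm]
  refine Finset.sum_congr rfl fun x _ => Finset.sum_congr rfl fun x' _ => ?_
  simp

/-- Splitting an `(m + l)`-fold composite system. -/
def splitPow (X : Type*) (m l : ℕ) : (Fin (m + l) → X) ≃ (Fin m → X) × (Fin l → X) where
  toFun u := (fun i => u (Fin.castAdd l i), fun i => u (Fin.natAdd m i))
  invFun p := Fin.append p.1 p.2
  left_inv _ := Fin.append_castAdd_natAdd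
  right_inv p := by simp

/-- Splitting an `(m + l)`-fold composite of input and output systems. -/
def splitPowProd (X Y : Type*) (m l : ℕ) :
    (Fin (m + l) → X) × (Fin (m + l) → Y) ≃
      ((Fin m → X) × (Fin m → Y)) × ((Fin l → X) × (Fin l → Y)) :=
  ((splitPow X m l).prodCongr (splitPow Y m l)).trans (Equiv.prodProdProdComm _ _ _ _)

theorem weightedChoi_tensorPower_add (N : SuperOp X Y) (m l : ℕ)
    {ω : Op (Fin m → X)} {ω' : Op (Fin l → X)} (hω : ω.PosSemidef) (hω' : ω'.PosSemidef) :
    weightedChoi (tensorPower N (m + l))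
        ((ω ⊗ₖ ω').submatrix (splitPow X m l) (splitPow X m l)) =
      (weightedChoi (tensorPower N m) ω ⊗ₖ weightedChoi (tensorPower N l) ω').submatrix
        (splitPowProd X Y m l) (splitPowProd X Y m l) := by
  have h1 : choi (tensorPower N (m + l)) =
      (choi (tensorPower N m) ⊗ₖ choi (tensorPower N l)).submatrix
      (splitPowProd X Y m l) (splitPowProd X Y m l) := by
    ext p q
    rw [submatrix_apply, kroneckerMap_apply, choi_apply, choi_apply, choi_apply,
      tensorPower_single, tensorPower_single, tensorPower_single]
    simp only [piTensor, of_apply]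
    rw [Fin.prod_univ_add]
    rfl
  have h2 : opPow ((ω ⊗ₖ ω').submatrix (splitPow X m l) (splitPow X m l)) (1 / 2) ⊗ₖ
      (1 : Op (Fin (m + l) → Y)) =
      ((opPow ω (1 / 2) ⊗ₖ (1 : Op (Fin m → Y))) ⊗ₖ
        (opPow ω' (1 / 2) ⊗ₖ (1 : Op (Fin l → Y)))).submatrix
        (splitPowProd X Y m l) (splitPowProd X Y m l) := by
    rw [opPow_submatrix (hω.kronecker hω').1, opPow_kronecker hω hω']
    have h3 : (1 : Op (Fin (m + l) → Y)) =
        ((1 : Op (Fin m → Y)) ⊗ₖ (1 : Op (Fin l → Y))).submatrix (splitPow Y m l)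
          (splitPow Y m l) := by
      rw [one_kronecker_one, submatrix_one_equiv]
    rw [h3]
    ext p q
    simp only [kroneckerMap_apply, submatrix_apply]
    exact mul_mul_mul_comm _ _ _ _
  rw [weightedChoi, h1, h2, submatrix_mul_equiv, submatrix_mul_equiv, ← mul_kronecker_mul,
    ← mul_kronecker_mul]
  rfl

/-- Near-optimal inputs `ω` and `ω'` combine to the input `ω ⊗ ω'`, on which the divergence is at
least the sum. Comparing numbers strictly below the two suprema avoids adding infinities. -/
theorem channelDiv_tensorPower_add {α : ℝ} (hα : 1 < α) {N M : SuperOp X Y} (hN : HasKraus N)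
    (hN1 : ∀ W, (N W).trace = W.trace) (hM : HasKraus M) (m l : ℕ) :
    channelDiv α (tensorPower N m) (tensorPower M m) +
      channelDiv α (tensorPower N l) (tensorPower M l) ≤
        channelDiv α (tensorPower N (m + l)) (tensorPower M (m + l)) := by
  refine EReal.add_le_of_forall_lt fun a ha b hb => ?_
  obtain ⟨ω, ha⟩ := lt_iSup_iff.1 ha
  obtain ⟨hω, ha⟩ := lt_iSup_iff.1 ha
  obtain ⟨ω', hb⟩ := lt_iSup_iff.1 hb
  obtain ⟨hω', hb⟩ := lt_iSup_iff.1 hb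
  refine (add_le_add ha.le hb.le).trans ?_
  have d1 := isDensity_weightedChoi (hN.tensorPower m) (trace_tensorPower hN1 m) hω
  have d2 := isDensity_weightedChoi (hN.tensorPower l) (trace_tensorPower hN1 l) hω'
  have e1 := weightedChoi_posSemidef (hM.tensorPower m) hω.1
  have e2 := weightedChoi_posSemidef (hM.tensorPower l) hω'.1
  refine (sandwichedDiv_kronecker hα d1 e1 d2 e2).trans ?_
  rw [← sandwichedDiv_submatrix α (d1.kronecker d2).1 (e1.kronecker e2) (splitPowProd X Y m l),
    ← weightedChoi_tensorPower_add N m l hω.1 hω'.1, ← weightedChoi_tensorPower_add M m l hω.1 hω'.1]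
  exact le_iSup₂ (f := fun (ω : Op (Fin (m + l) → X)) (_ : IsDensity ω) =>
    sandwichedDiv α (weightedChoi (tensorPower N (m + l)) ω)
      (weightedChoi (tensorPower M (m + l)) ω)) _ ((hω.kronecker hω').submatrix (splitPow X m l))

theorem channelDiv_ne_bot [Nonempty X] {α : ℝ} (hα : 1 < α) {N M : SuperOp X Y} (hN : HasKraus N)
    (hN1 : ∀ W, (N W).trace = W.trace) (hM : HasKraus M) : channelDiv α N M ≠ ⊥ := by
  obtain ⟨x⟩ := ‹Nonempty X›
  have hω : IsDensity (diagonal (Pi.single x 1) : Op X) := by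
    refine ⟨PosSemidef.diagonal fun z => ?_, ?_⟩
    · by_cases h : z = x
      · subst h; simp
      · simp [h]
    · rw [trace_diagonal, Finset.sum_pi_single']
      simp
  refine ne_bot_of_le_ne_bot (sandwichedDiv_ne_bot hα (isDensity_weightedChoi hN hN1 hω)
    (weightedChoi_posSemidef hM hω.1)) ?_
  exact le_iSup₂ (f := fun (ω : Op X) (_ : IsDensity ω) =>
    sandwichedDiv α (weightedChoi N ω) (weightedChoi M ω)) _ hω

end Superadditive

open Filter Topology in
/-- Fekete's lemma for superadditive sequences in `(-∞, ∞]`. -/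
theorem exists_tendsto_div_of_superadditive {D : ℕ → EReal} (h0 : ∀ m, D m ≠ ⊥)
    (hs : ∀ m l, D m + D l ≤ D (m + l)) :
    ∃ L : EReal, L ≠ ⊥ ∧ Tendsto (fun m : ℕ => D m / (m : EReal)) atTop (𝓝 L) ∧
      ((∃ m, D m = ⊤) → L = ⊤) := by
  by_cases htop : ∃ m, D m = ⊤
  · refine ⟨⊤, top_ne_bot, ?_, fun _ => rfl⟩
    obtain ⟨m, hm⟩ := htop
    refine tendsto_const_nhds.congr' ?_
    filter_upwards [eventually_ge_atTop (m + 1)] with l hl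
    -- One infinite term makes all later terms infinite, because no term is `⊥`.
    have hl' : D l = ⊤ := by
      have := hs m (l - m)
      rw [hm, EReal.top_add_of_ne_bot (h0 _), top_le_iff, Nat.add_sub_cancel' (by omega)] at this
      exact this
    rw [hl', EReal.top_div_of_pos_ne_top]
    · exact_mod_cast (by omega : 0 < l)
    · exact EReal.natCast_ne_top l
  · push Not at htop
    have hd (m : ℕ) : D m = ((D m).toReal : EReal) := (EReal.coe_toReal (htop m) (h0 m)).symm
    set d : ℕ → ℝ := fun m => (D m).toReal
    have hdiv (m : ℕ) : D m / (m : EReal) = ((d m / m : ℝ) : EReal) := by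
      rw [hd m, EReal.coe_div]
      rfl
    have hsub : Subadditive fun m => -d m := fun m l => by
      have := hs m l
      rw [hd m, hd l, hd (m + l), ← EReal.coe_add, EReal.coe_le_coe_iff] at this
      simp only [d]
      linarith
    refine ⟨⨆ m : ℕ, ⨆ _ : m ≠ 0, ((d m / m : ℝ) : EReal), ?_, ?_, fun ⟨m, hm⟩ => (htop m hm).elim⟩
    · refine ne_bot_of_le_ne_bot (EReal.coe_ne_bot (d 1 / (1 : ℕ))) ?_
      exact le_iSup₂ (f := fun (m : ℕ) (_ : m ≠ 0) => ((d m / m : ℝ) : EReal)) 1 one_ne_zero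
    · simp only [hdiv]
      -- The supremum may be `⊤` even when every term is finite, so only Fekete's one-sided estimate
      -- is used for the lower bound; the upper bound is immediate.
      refine tendsto_order.2 ⟨fun a ha => ?_, fun a ha => ?_⟩
      · obtain ⟨m, ha⟩ := lt_iSup_iff.1 ha
        obtain ⟨hm, ha⟩ := lt_iSup_iff.1 ha
        induction a with
        | bot => exact Eventually.of_forall fun _ => EReal.bot_lt_coe _
        | top => exact absurd ha not_top_lt
        | coe c =>
          rw [EReal.coe_lt_coe_iff] at ha
          have := hsub.eventually_div_lt_of_div_lt (L := -c) hm (by rw [neg_div]; linarith)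
          filter_upwards [this] with p hp
          rw [neg_div] at hp
          rw [EReal.coe_lt_coe_iff]
          linarith
      · filter_upwards [eventually_ne_atTop 0] with p hp
        exact (le_iSup₂ (f := fun (m : ℕ) (_ : m ≠ 0) => ((d m / m : ℝ) : EReal)) p hp).trans_lt ha

/-! ## Trace norms and `PPT'` -/

section TraceNorm

variable {X Y : Type*} [Fintype X] [DecidableEq X] [Fintype Y] [DecidableEq Y]

theorem traceNorm_eq (W : Op X) : traceNorm W = (opPow (Wᴴ * W) (1 / 2)).trace.re := by
  rw [((diagonalizes_of_isHermitian (isHermitian_conjTranspose_mul_self W)).opPow _).trace,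
    ← Complex.ofReal_sum, Complex.ofReal_re]
  simp only [traceNorm, Real.sqrt_eq_rpow]

theorem traceNorm_submatrix (W : Op X) (e : Y ≃ X) :
    traceNorm (W.submatrix e e) = traceNorm W := by
  rw [traceNorm_eq, traceNorm_eq, conjTranspose_submatrix, submatrix_mul_equiv,
    opPow_submatrix (isHermitian_conjTranspose_mul_self W)]
  exact congrArg Complex.re (e.sum_comp fun x => opPow (Wᴴ * W) (1 / 2) x x)

omit [DecidableEq X] in
theorem sum_normSq_eq_conjTranspose_mul_diag {J : Type*} (T : Matrix X J ℂ) (j : J) :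
    ((∑ k, ‖T k j‖ ^ 2 : ℝ) : ℂ) = (Tᴴ * T) j j := by
  rw [Matrix.mul_apply, Complex.ofReal_sum]
  refine Finset.sum_congr rfl fun k _ => ?_
  rw [conjTranspose_apply, RCLike.star_def, ← Complex.normSq_eq_conj_mul_self,
    Complex.normSq_eq_norm_sq]

/-- In an eigenbasis `V` of `Wᴴ W`, the `j`-th columns of `W V` have the singular values as norms,
while the rows of `Vᴴ S` are unit vectors; apply Cauchy–Schwarz to each diagonal entry. -/
theorem trace_mul_unitary_le_traceNorm (W : Op X) {S : Op X} (hS : S * Sᴴ = 1) :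
    (W * S).trace.re ≤ traceNorm W := by
  have hH := isHermitian_conjTranspose_mul_self W
  have h := diagonalizes_of_isHermitian hH
  set V : Matrix X X ℂ := (hH.eigenvectorUnitary : Matrix X X ℂ)
  have e : (W * S).trace = (Vᴴ * S * (W * V)).trace := by
    have : W * S = W * (V * Vᴴ) * S := by rw [h.mul_conjTranspose_self, Matrix.mul_one]
    rw [this, ← Matrix.mul_assoc W, Matrix.mul_assoc (W * V), trace_mul_comm]
  rw [e, trace, Complex.re_sum, traceNorm]
  refine Finset.sum_le_sum fun j _ => ?_
  have h1 : ∑ k, ‖(Vᴴ * S) j k‖ ^ 2 = 1 := by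
    have h2 := sum_normSq_eq_conjTranspose_mul_diag (Vᴴ * S)ᴴ j
    have h3 : (Vᴴ * S) * (Vᴴ * S)ᴴ = 1 := by
      rw [conjTranspose_mul, conjTranspose_conjTranspose, Matrix.mul_assoc, ← Matrix.mul_assoc S,
        hS, Matrix.one_mul, h.conjTranspose_mul_self]
    rw [conjTranspose_conjTranspose, h3, one_apply_eq] at h2
    simp only [conjTranspose_apply, norm_star] at h2
    exact_mod_cast h2
  have h2 : ∑ k, ‖(W * V) k j‖ ^ 2 = hH.eigenvalues j := by
    have h2 := sum_normSq_eq_conjTranspose_mul_diag (W * V) j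
    have h3 : (W * V)ᴴ * (W * V) = Vᴴ * (Wᴴ * W) * V := by
      simp only [conjTranspose_mul, Matrix.mul_assoc]
    rw [h3, h.conj_eq, diagonal_apply_eq] at h2
    exact_mod_cast h2
  rw [diag_apply, Matrix.mul_apply, Complex.re_sum]
  calc ∑ k, ((Vᴴ * S) j k * (W * V) k j).re
      ≤ ∑ k, ‖(Vᴴ * S) j k‖ * ‖(W * V) k j‖ := Finset.sum_le_sum fun k _ => by
        rw [← norm_mul]; exact Complex.re_le_norm _
    _ ≤ √(∑ k, ‖(Vᴴ * S) j k‖ ^ 2) * √(∑ k, ‖(W * V) k j‖ ^ 2) :=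
        Real.sum_mul_le_sqrt_mul_sqrt _ _ _
    _ = _ := by rw [h1, h2, Real.sqrt_one, one_mul]

theorem bellPower_apply (k : ℕ) (p q : (Fin k → Fin 2) × (Fin k → Fin 2)) :
    bellPower k p q = if p.1 = p.2 ∧ q.1 = q.2 then (1 / 2) ^ k else 0 := by
  have hb (a b : Fin 2 × Fin 2) :
      bellState a b = if a.1 = a.2 ∧ b.1 = b.2 then 1 / 2 else 0 := by
    have h2 : (((1 / √2 : ℝ) : ℂ)) * ((1 / √2 : ℝ) : ℂ) = 1 / 2 := by
      rw [← Complex.ofReal_mul, div_mul_div_comm, Real.mul_self_sqrt (by norm_num)]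
      norm_num
    have hs : star ((1 / √2 : ℝ) : ℂ) = ((1 / √2 : ℝ) : ℂ) := Complex.conj_ofReal _
    rw [bellState, vecMulVec_apply, Pi.star_apply]
    by_cases h1 : a.1 = a.2 <;> by_cases h3 : b.1 = b.2 <;>
      simp only [bellVec, h1, h3, if_true, if_false, and_true, and_false, star_zero,
        mul_zero, zero_mul, hs, h2]
  simp only [bellPower, of_apply, hb]
  split_ifs with h
  · rw [Finset.prod_congr rfl fun i _ => if_pos ⟨congrFun h.1 i, congrFun h.2 i⟩]
    simp
  · have : ∃ i, ¬(p.1 i = p.2 i ∧ q.1 i = q.2 i) := by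
      by_contra hc
      push Not at hc
      exact h ⟨funext fun i => (hc i).1, funext fun i => (hc i).2⟩
    obtain ⟨i, hi⟩ := this
    exact Finset.prod_eq_zero (Finset.mem_univ i) (if_neg hi)

theorem bellPower_isHermitian (k : ℕ) : (bellPower k).IsHermitian := by
  ext p q
  rw [conjTranspose_apply, bellPower_apply, bellPower_apply]
  by_cases h1 : p.1 = p.2 <;> by_cases h2 : q.1 = q.2 <;> simp [h1, h2]

theorem bellPower_mul_self (k : ℕ) : bellPower k * bellPower k = bellPower k := by
  ext p q
  rw [Matrix.mul_apply, Fintype.sum_prod_type]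
  simp only [bellPower_apply, ite_and]
  by_cases h1 : p.1 = p.2 <;> by_cases h2 : q.1 = q.2 <;> simp [h1, h2]

theorem bellPower_posSemidef (k : ℕ) : (bellPower k).PosSemidef := by
  have := posSemidef_conjTranspose_mul_self (bellPower k)
  rwa [(bellPower_isHermitian k).eq, bellPower_mul_self] at this

theorem one_sub_bellPower_posSemidef (k : ℕ) : (1 - bellPower k).PosSemidef := by
  have := posSemidef_conjTranspose_mul_self (1 - bellPower k)
  rw [conjTranspose_sub, conjTranspose_one, (bellPower_isHermitian k).eq, Matrix.mul_sub,
    Matrix.sub_mul, Matrix.sub_mul, bellPower_mul_self] at this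
  simpa using this

/-- Elements of `PPT'` overlap with `k` Bell pairs at most as `2^{-k}`. -/
theorem trace_mul_bellPower_le {k : ℕ} {σ : Op ((Fin k → Fin 2) × (Fin k → Fin 2))}
    (hσ : σ ∈ PPTPrime (Fin k → Fin 2) (Fin k → Fin 2)) :
    (bellPower k * σ).trace.re ≤ (1 / 2) ^ k := by
  -- `S` is the swap. The partial transpose of `Ψ^{⊗k}` is `2 ^ (-k)` times the swap, so the overlap
  -- is `2 ^ (-k)` times the trace of the partial transpose of `σ` against a unitary.
  set S : Op ((Fin k → Fin 2) × (Fin k → Fin 2)) :=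
    (1 : Op ((Fin k → Fin 2) × (Fin k → Fin 2))).submatrix (Equiv.prodComm _ _) id
  have hS : S * Sᴴ = 1 := by
    simp only [S]
    rw [conjTranspose_submatrix, ← submatrix_mul _ _ _ id _ Function.bijective_id,
      conjTranspose_one, Matrix.one_mul, submatrix_one_equiv]
  have h := (trace_mul_unitary_le_traceNorm (partialTranspose σ) hS).trans hσ.2
  have hS' (a b : (Fin k → Fin 2) × (Fin k → Fin 2)) : S a b = if a.swap = b then 1 else 0 := by
    simp [S, one_apply]
  have e : (bellPower k * σ).trace = ((1 / 2 : ℝ) ^ k : ℝ) * (partialTranspose σ * S).trace := by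
    rw [trace_mul_comm]
    simp only [trace, diag_apply, Matrix.mul_apply, bellPower_apply, hS', Finset.mul_sum]
    have h1 : ∀ p : (Fin k → Fin 2) × (Fin k → Fin 2),
        ∑ q, (((1 / 2 : ℝ) ^ k : ℝ) : ℂ) * (partialTranspose σ p q *
          if q.swap = p then 1 else 0) = (1 / 2) ^ k * partialTranspose σ p p.swap := fun p => by
      rw [Finset.sum_eq_single p.swap]
      · simp
      · intro q _ hq
        rw [if_neg fun h => hq (by rw [← h, Prod.swap_swap])]
        simp
      · simp
    rw [Finset.sum_congr rfl fun p _ => h1 p]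
    simp only [Fintype.sum_prod_type, partialTranspose, of_apply, Prod.swap, ite_and]
    refine Finset.sum_congr rfl fun a _ => ?_
    rw [Finset.sum_eq_single a]
    · simp [mul_comm]
    · intro c _ hc
      simp [hc.symm]
    · simp
  rw [e, Complex.re_ofReal_mul]
  exact mul_le_of_le_one_right (by positivity) h

variable {A B : Type*} [Fintype A] [DecidableEq A] [Fintype B] [DecidableEq B]

/-- Maps in `V_Θ` preserve `PPT'` when the channel system is handed over. -/
theorem applyMiddle_mem_PPTPrime {M : SuperOp X Y} (hM : M ∈ VTheta X Y)
    {σ : Op ((A × X) × B)} (hσ : σ ∈ PPTPrime (A × X) B) :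
    applyMiddle A B M σ ∈ PPTPrime A (Y × B) := by
  refine ⟨(hM.1.hasKraus.applyMiddle A B).posSemidef hσ.1, ?_⟩
  set c := Fintype.equivFin (A × B)
  let ein : Fin (Fintype.card (A × B)) × X ≃ (A × X) × B :=
    { toFun := fun p => (((c.symm p.1).1, p.2), (c.symm p.1).2)
      invFun := fun q => (c (q.1.1, q.2), q.1.2)
      left_inv := fun p => by simp
      right_inv := fun q => by simp }
  let eout : Fin (Fintype.card (A × B)) × Y ≃ A × (Y × B) :=
    { toFun := fun p => ((c.symm p.1).1, (p.2, (c.symm p.1).2))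
      invFun := fun q => (c (q.1, q.2.2), q.2.1)
      left_inv := fun p => by simp
      right_inv := fun q => by simp }
  set W : Op (Fin (Fintype.card (A × B)) × X) := (partialTranspose σ).submatrix ein ein
  have hW : traceNorm W ≤ 1 := by
    rw [traceNorm_submatrix]
    exact hσ.2
  -- Transposing `Y B` after `M` is the same as transposing `B` first and then applying `Θ ∘ M`.
  -- With `A B` together as the reference, this is the situation of the diamond norm.
  have hout : (partialTranspose (applyMiddle A B M σ)).submatrix eout eout =
      idTensor (Fin (Fintype.card (A × B))) (transposeMap Y ∘ₗ M) W := rfl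
  have h1 : ENNReal.ofReal (traceNorm
      (idTensor (Fin (Fintype.card (A × B))) (transposeMap Y ∘ₗ M) W)) ≤ 1 := by
    refine le_trans ?_ hM.2
    unfold diamondNorm
    refine le_iSup_of_le (Fintype.card (A × B)) (le_iSup_of_le W (le_iSup_of_le hW le_rfl))
  rw [← hout, traceNorm_submatrix] at h1
  simpa using h1

end TraceNorm

/-! ## The protocol -/

section Protocol

variable {X Y : Type*} [Fintype X] [DecidableEq X] [Fintype Y] [DecidableEq Y]
  {N M : SuperOp X Y} {n : ℕ} {A B : ℕ → Type*}
  [∀ i, Fintype (A i)] [∀ i, DecidableEq (A i)] [∀ i, Fintype (B i)] [∀ i, DecidableEq (B i)]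
  {A' B' : Type*} [Fintype A'] [DecidableEq A'] [Fintype B'] [DecidableEq B']

omit [DecidableEq X] [DecidableEq Y] in
theorem trace_applyMiddle {A B : Type*} [Fintype A] [Fintype B]
    (hN : ∀ W, (N W).trace = W.trace) (W : Op ((A × X) × B)) :
    (applyMiddle A B N W).trace = W.trace := by
  simp only [trace, diag_apply, Fintype.sum_prod_type]
  refine Finset.sum_congr rfl fun a _ => ?_
  rw [Finset.sum_comm]
  refine Eq.trans ?_ Finset.sum_comm
  refine Finset.sum_congr rfl fun b _ => ?_
  exact hN (of fun x x' => W ((a, x), b) ((a, x'), b))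

theorem MeasuredBound.refl {Z : Type*} [Fintype Z] [DecidableEq Z] {α : ℝ} (hα : 1 < α) (m : ℕ)
    {ρ : Op Z} (hρ : IsDensity ρ) : MeasuredBound α m ρ ρ 1 := fun r E hE => by
  refine (measuredSum_self_le hα hE (piTensor_posSemidef fun _ => hρ.1)).trans ?_
  rw [trace_piTensor]
  simp [hρ.2]

omit [DecidableEq Y] in
theorem IsChannel.isDensity {F : SuperOp X Y} (hF : IsChannel F) {ρ : Op X} (hρ : IsDensity ρ) :
    IsDensity (F ρ) :=
  ⟨hF.1.hasKraus.posSemidef hρ.1, by rw [hF.2, hρ.2]⟩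

/-- The states of the protocol, and the comparison operators in `PPT'` obtained by replacing `N`
with `M`. -/
theorem PPTProtocol.exists_comparison (P : PPTProtocol N n A B A' B') (hN : IsChannel N)
    (hM : M ∈ VTheta X Y) {α : ℝ} (hα : 1 < α) {d : ℕ → ℝ}
    (hd : ∀ m, channelDiv α (tensorPower N m) (tensorPower M m) ≤ (d m : EReal)) (i : ℕ)
    (hi : 1 ≤ i) : i ≤ n → IsDensity (P.ρ i) ∧ ∃ σ ∈ PPTPrime (A i × X) (B i), ∃ K : ℕ, ∀ m : ℕ,
      MeasuredBound α m (P.ρ i) σ (((m + 1 : ℕ) : ENNReal) ^ K *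
        ENNReal.ofReal (2 ^ ((α - 1) * d m)) ^ (i - 1)) := by
  induction i, hi using Nat.le_induction with
  | base =>
    intro _
    have h1 : IsDensity (P.ρ 1) := by
      rw [P.ρ_one]
      exact P.first_channel.isDensity P.init_density
    -- The two runs agree before the first use of the channel, so the bound starts at one; the
    -- exponent `i - 1` counts the uses made before time `i`.
    refine ⟨h1, P.ρ 1, ?_, 0, fun m => ?_⟩
    · rw [P.ρ_one]
      exact P.first_ppt _ P.init_ppt
    · simpa using MeasuredBound.refl hα m h1
  | succ i hi ih =>
    intro hin
    obtain ⟨hρ, σ, hσ, K, hK⟩ := ih (by omega)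
    have hF := P.mid_channel i hi (by omega)
    have hmid : IsDensity (applyMiddle (A i) (B i) N (P.ρ i)) :=
      ⟨(hN.1.hasKraus.applyMiddle _ _).posSemidef hρ.1, by rw [trace_applyMiddle hN.2, hρ.2]⟩
    rw [P.ρ_succ i hi (by omega)]
    refine ⟨hF.isDensity hmid, P.mid i (applyMiddle (A i) (B i) M σ),
      P.mid_ppt i hi (by omega) _ (applyMiddle_mem_PPTPrime hM hσ),
      Fintype.card ((A i × X) × B i) * ⌈α⌉₊ + K, fun m => ?_⟩
    have := (hK m).step hα hN.1.hasKraus hM.1.hasKraus (hd m) hF.1.hasKraus hF.2 hρ.1 hσ.1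
    rw [mul_assoc, ← pow_succ, ← mul_assoc, ← pow_add, Nat.sub_add_cancel hi] at this
    exact this

theorem PPTProtocol.exists_comparison_output (P : PPTProtocol N n A B A' B') (hn : 1 ≤ n)
    (hN : IsChannel N) (hM : M ∈ VTheta X Y) {α : ℝ} (hα : 1 < α) {d : ℕ → ℝ}
    (hd : ∀ m, channelDiv α (tensorPower N m) (tensorPower M m) ≤ (d m : EReal)) :
    IsDensity P.output ∧ ∃ σ ∈ PPTPrime A' B', ∃ K : ℕ, ∀ m : ℕ,
      MeasuredBound α m P.output σ (((m + 1 : ℕ) : ENNReal) ^ K *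
        ENNReal.ofReal (2 ^ ((α - 1) * d m)) ^ n) := by
  obtain ⟨hρ, σ, hσ, K, hK⟩ := P.exists_comparison hN hM hα hd n hn le_rfl
  have hF := P.last_channel
  have hmid : IsDensity (applyMiddle (A n) (B n) N (P.ρ n)) :=
    ⟨(hN.1.hasKraus.applyMiddle _ _).posSemidef hρ.1, by rw [trace_applyMiddle hN.2, hρ.2]⟩
  refine ⟨hF.isDensity hmid, P.last (applyMiddle (A n) (B n) M σ),
    P.last_ppt _ (applyMiddle_mem_PPTPrime hM hσ),
    Fintype.card ((A n × X) × B n) * ⌈α⌉₊ + K, fun m => ?_⟩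
  have := (hK m).step hα hN.1.hasKraus hM.1.hasKraus (hd m) hF.1.hasKraus hF.2 hρ.1 hσ.1
  rw [mul_assoc, ← pow_succ, ← mul_assoc, ← pow_add, Nat.sub_add_cancel hn] at this
  exact this

/-- A trace-one operator on a system containing `X` exists. Without an input state the channel
divergence would be a supremum over the empty set, that is `⊥`. -/
theorem PPTProtocol.nonempty_input (P : PPTProtocol N n A B A' B') : Nonempty X := by
  by_contra h
  rw [not_nonempty_iff] at h
  have := (P.first_channel.isDensity P.init_density).2
  simp [trace] at this

/-- The converse bound for a single number `m` of copies of the protocol. -/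
theorem PPTProtocol.exists_log_bound {k : ℕ}
    (P : PPTProtocol N n A B (Fin k → Fin 2) (Fin k → Fin 2)) (hn : 1 ≤ n)
    (hN : IsChannel N) (hM : M ∈ VTheta X Y) {α : ℝ} (hα : 1 < α) {d : ℕ → ℝ}
    (hd : ∀ m, channelDiv α (tensorPower N m) (tensorPower M m) ≤ (d m : EReal)) {ε : ℝ}
    (hε : ε < 1) (hP : 1 - ε ≤ (P.output * bellPower k).trace.re) :
    ∃ K : ℕ, ∀ m : ℕ, (m : ℝ) * (α * Real.logb 2 (1 - ε) + k * (α - 1)) ≤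
      K * Real.logb 2 (m + 1) + n * ((α - 1) * d m) := by
  obtain ⟨hρ, σ, hσ, K, hK⟩ := P.exists_comparison_output hn hN hM hα hd
  refine ⟨K, fun m => ?_⟩
  -- A single effect suffices: all `m` copies pass the Bell test.
  have hE : IsSubPOVM fun _ : Fin 1 => opTensorPow (bellPower k) m :=
    ⟨fun _ => piTensor_posSemidef fun _ => bellPower_posSemidef k, by
      simpa using one_sub_opTensorPow_posSemidef (bellPower_posSemidef k)
        (one_sub_bellPower_posSemidef k) m⟩
  have h1 := hK m 1 _ hE
  have hε0 : 0 < 1 - ε := by linarith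
  have hms : measuredSum α (fun _ : Fin 1 => opTensorPow (bellPower k) m) (opTensorPow P.output m)
      (opTensorPow σ m) =
      renyiWeight α (bellPower k * P.output).trace.re (bellPower k * σ).trace.re ^ m := by
    simp only [measuredSum, Finset.univ_unique, Finset.sum_singleton]
    rw [trace_piTensor_mul_re (fun _ => bellPower_posSemidef k) fun _ => hρ.1,
      trace_piTensor_mul_re (fun _ => bellPower_posSemidef k) fun _ => hσ.1,
      renyiWeight_prod _ (fun _ => trace_mul_re_nonneg (bellPower_posSemidef k) hρ.1)
        fun _ => trace_mul_re_nonneg (bellPower_posSemidef k) hσ.1]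
    simp
  rw [hms] at h1
  rw [trace_mul_comm] at hP
  -- The weight increases with the success probability and decreases with the comparison overlap, so
  -- both bounds act in the same direction.
  have h2 := (pow_le_pow_left' (renyiWeight_mono hα hP (trace_mul_bellPower_le hσ)) m).trans h1
  rw [renyiWeight_eq_ofReal hα hε0.le (by positivity), ← ENNReal.ofReal_pow (by positivity),
    ← ENNReal.ofReal_natCast, ← ENNReal.ofReal_pow (by positivity),
    ← ENNReal.ofReal_pow (by positivity), ← ENNReal.ofReal_mul (by positivity),
    ENNReal.ofReal_le_ofReal_iff (by positivity)] at h2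
  have h3 := Real.logb_le_logb_of_le (b := 2) (by norm_num) (by positivity) h2
  rw [Real.logb_pow, Real.logb_mul (by positivity) (by positivity),
    Real.logb_mul (by positivity) (by positivity), Real.logb_pow, Real.logb_pow,
    Real.logb_rpow (by norm_num) (by norm_num), Real.logb_rpow_eq_mul_logb_of_pos hε0,
    Real.logb_rpow_eq_mul_logb_of_pos (by positivity), Real.logb_pow, one_div, Real.logb_inv,
    Real.logb_self_eq_one (by norm_num)] at h3
  push_cast at h3
  linarith

end Protocol

end QInfo

/-! ### The limit of many copies -/

open QInfo in
theorem mainTheorem11 {X Y : Type*} [Fintype X] [DecidableEq X] [Fintype Y] [DecidableEq Y]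
    (N : SuperOp X Y) (hN : IsChannel N)
    (n k : ℕ) (hn : 1 ≤ n) (hk : 1 ≤ k) (ε : ℝ) (hε : ε ∈ Set.Icc (0 : ℝ) 1)
    (A B : ℕ → Type*)
    [∀ i, Fintype (A i)] [∀ i, DecidableEq (A i)] [∀ i, Fintype (B i)] [∀ i, DecidableEq (B i)]
    (P : PPTProtocol N n A B (Fin k → Fin 2) (Fin k → Fin 2))
    (hP : 1 - ε ≤ (P.output * bellPower k).trace.re)
    (α : ℝ) (hα : 1 < α) (M : SuperOp X Y) (hM : M ∈ VTheta X Y) :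
    Filter.Tendsto (channelDivRate α N M) Filter.atTop (nhds (regChannelDiv α N M)) ∧
      (((k : ℝ) / (n : ℝ) : ℝ) : EReal) ≤
        regChannelDiv α N M - ((α / (n * (α - 1)) : ℝ) : EReal) * log2 (1 - ε) := by
  have hX := P.nonempty_input
  set D : ℕ → EReal := fun m => channelDiv α (tensorPower N m) (tensorPower M m)
  have hKN := hN.1.hasKraus
  have hKM := hM.1.hasKraus
  have hD0 (m : ℕ) : D m ≠ ⊥ :=
    channelDiv_ne_bot hα (hKN.tensorPower m) (trace_tensorPower hN.2 m) (hKM.tensorPower m)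
  obtain ⟨L, hL0, hL, hLtop⟩ := exists_tendsto_div_of_superadditive hD0
    fun m l => channelDiv_tensorPower_add hα hKN hN.2 hKM m l
  have hreg : regChannelDiv α N M = L := Filter.Tendsto.limUnder_eq hL
  rw [hreg]
  refine ⟨hL, ?_⟩
  have hn0 : (0 : ℝ) < n := by exact_mod_cast hn
  have hc : 0 < α / (n * (α - 1)) := div_pos (by linarith) (mul_pos hn0 (by linarith))
  rcases hε.2.eq_or_lt with rfl | hε1
  -- For `ε = 1` the correction term is `-∞`; since `L ≠ ⊥`, the right-hand side is `⊤`.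
  · have : log2 (1 - 1) = ⊥ := if_pos (by norm_num)
    rw [this, EReal.coe_mul_bot_of_pos hc, sub_eq_add_neg, EReal.neg_bot,
      EReal.add_top_of_ne_bot hL0]
    exact le_top
  rw [log2_of_pos (by linarith), ← EReal.coe_mul]
  induction L with
  | bot => exact absurd rfl hL0
  | top => rw [EReal.top_sub_coe]; exact le_top
  | coe x =>
    -- A finite limit rules out any infinite `m`-copy divergence, so real-valued bounds are
    -- available for every `m`.
    have htop : ∀ m, D m ≠ ⊤ := fun m hm => EReal.coe_ne_top x (hLtop ⟨m, hm⟩)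
    set d : ℕ → ℝ := fun m => (D m).toReal
    have hd (m : ℕ) : D m = (d m : EReal) := (EReal.coe_toReal (htop m) (hD0 m)).symm
    have hdx : Filter.Tendsto (fun m : ℕ => d m / m) Filter.atTop (nhds x) := by
      rw [← EReal.tendsto_coe]
      refine hL.congr fun m => ?_
      rw [hd m, EReal.coe_div]
      rfl
    obtain ⟨K, hK⟩ := P.exists_log_bound hn hN hM hα (fun m => (hd m).le) hε1 hP
    have hlog : Filter.Tendsto (fun m : ℕ => Real.log (m + 1) / m) Filter.atTop (nhds 0) := by
      -- This is `log t / (t - 1) → 0` evaluated at `t = m + 1`.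
      have h := (Real.tendsto_pow_log_div_mul_add_atTop 1 (-1) 1 one_ne_zero).comp
        (tendsto_natCast_atTop_atTop.comp (Filter.tendsto_add_atTop_nat 1))
      refine h.congr fun m => ?_
      simp
    have hlim : Filter.Tendsto (fun m : ℕ => K / (Real.log 2 * (n * (α - 1))) *
        (Real.log (m + 1) / m) + d m / m) Filter.atTop (nhds x) := by
      have := (hlog.const_mul (K / (Real.log 2 * (n * (α - 1))))).add hdx
      rwa [mul_zero, zero_add] at this
    have hbound : k / n + α / (n * (α - 1)) * Real.logb 2 (1 - ε) ≤ x := by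
      -- Dividing the `m`-copy bound by `m n (α - 1)` leaves the polynomial factor as a multiple of
      -- `log (m + 1) / m`, which vanishes in the limit.
      refine ge_of_tendsto hlim ?_
      filter_upwards [Filter.eventually_gt_atTop 0] with m hm
      have hm0 : (0 : ℝ) < m := by exact_mod_cast hm
      have hα1 : 0 < α - 1 := by linarith
      have hl2 : 0 < Real.log 2 := Real.log_pos (by norm_num)
      have h := hK m
      have e1 : k / n + α / (n * (α - 1)) * Real.logb 2 (1 - ε) =
          (m * (α * Real.logb 2 (1 - ε) + k * (α - 1))) / (m * (n * (α - 1))) := by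
        field_simp
        ring
      have e2 : K / (Real.log 2 * (n * (α - 1))) * (Real.log (m + 1) / m) + d m / m =
          (K * Real.logb 2 (m + 1) + n * ((α - 1) * d m)) / (m * (n * (α - 1))) := by
        rw [Real.logb]
        field_simp
      rw [e1, e2]
      exact div_le_div_of_nonneg_right h (by positivity)
    rw [← EReal.coe_sub, EReal.coe_le_coe_iff]
    linarith
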